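/- Let $n\in\mathbb{N}$, let $A\in\mathbb{R}^{n\times n}$ be stable (all complex eigenvalues of modulus $<1$), and let $b,c^{\mathsf T}\in\mathbb{R}^n$ define the discrete-time system $x(t+1)=Ax(t)+bu(t)$, $y(t)=cx(t)$. The variation of a real vector or sequence is its number of sign changes after all zeros have been deleted (in particular the variation of $0$ is $0$). A linear map $u\mapsto Xu$ is $\mathrm{OVD}_{m}$ if for every $u$ in its domain with variation at most $m$: (i) the variation of $Xu$ is at most that of $u$; (ii) if the two variations are equal and $u$, $Xu$ are nonzero, then the first nonzero entries of $u$ and $Xu$ have the same sign. For $k\in\{1,2,\dots\}\cup\{\infty\}$, $(A,b,c)$ is called internally Hankel $k$-positive if the following three maps are $\mathrm{OVD}_{k-1}$: the map $x\mapsto Ax$ on $\mathbb{R}^n$; the controllability operator $\mathcal{C}(A,b)$, which sends a bounded past input $(u(-1),u(-2),u(-3),\dots)$, listed in this order, to $\sum_{s=0}^{\infty}A^{s}b\,u(-1-s)\in\mathbb{R}^n$; and the observability operator $\mathcal{O}(A,c)$, which sends $x_0\in\mathbb{R}^n$ to the sequence $(cA^{t}x_0)_{t\ge 0}$. For a matrix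 $X\in\mathbb{R}^{p\times q}$ let $X_{[j]}\in\mathbb{R}^{\binom pj\times\binom qj}$ be its $j$-th multiplicative compound, the matrix of all $j\times j$ minors of $X$ (empty if $j>\min(p,q)$). Put $\mathcal{C}^j(A,b)=(b,Ab,\dots,A^{j-1}b)\in\mathbb{R}^{n\times j}$ and $\mathcal{O}^j(A,c)=\mathcal{C}^j(A^{\mathsf T},c^{\mathsf T})^{\mathsf T}\in\mathbb{R}^{j\times n}$. A system is internally positive if for every nonnegative initial state and every nonnegative input $(u(t))_{t\ge0}$ all states $x(t)$ and outputs $y(t)$, $t\ge 0$, are nonnegative. **Theorem.** Let $1\le k\le\infty$. The following are equivalent: 1. $(A,b,c)$ is internally Hankel $k$-positive; 2. for every integer $j$ with $1\le j\le k$, the system $\bigl(A_{[j]},\,\mathcal{C}^j(A,b)_{[j]},\,\mathcal{O}^j(A,c)_{[j]}\bigr)$ is internally positive; 3. for every integer $j$ with $1\le j\le k$, the matrices $A_{[j]}$, $\mathcal{C}^j(A,b)_{[j]}$ and $\mathcal{O}^j(A,c)_{[j]}$ are entrywise nonnegative. -/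

import Mathlib

open Matrix

namespace HankelPos

noncomputable section

/-- The variation (number of sign changes) of a real vector or sequence: the number of pairs of
entries of opposite sign all of whose intermediate entries vanish, that is, of sign changes between
neighbours once all zeros have been deleted. It is `⊤` if there are infinitely many. -/
def variation {ι : Type*} [LinearOrder ι] (u : ι → ℝ) : ℕ∞ :=
  {p : ι × ι | p.1 < p.2 ∧ u p.1 * u p.2 < 0 ∧ ∀ l, p.1 < l → l < p.2 → u l = 0}.encard

/-- `i` is the position of the first nonzero entry of `u`. -/
def IsFirstNonzero {ι : Type*} [LinearOrder ι] (u : ι → ℝ) (i : ι) : Prop :=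
  u i ≠ 0 ∧ ∀ l, l < i → u l = 0

/-- The map `X`, on the set `D` of admissible arguments, is order-preserving `k`-variation
diminishing. The sign condition is void if `u` or `X u` has no nonzero entry. -/
def IsOVD {ι κ : Type*} [LinearOrder ι] [LinearOrder κ] (k : ℕ∞) (D : Set (ι → ℝ))
    (X : (ι → ℝ) → (κ → ℝ)) : Prop :=
  ∀ u ∈ D, variation u ≤ k →
    variation (X u) ≤ variation u ∧
    (variation (X u) = variation u → ∀ i j, IsFirstNonzero u i → IsFirstNonzero (X u) j →
      SignType.sign (X u j) = SignType.sign (u i))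

/-- The data `(A, b, c)` of a single-input single-output discrete-time linear system
`x(t+1) = A x(t) + b u(t)`, `y(t) = c x(t)`. -/
structure System (ι : Type*) where
  A : Matrix ι ι ℝ
  b : ι → ℝ
  c : ι → ℝ

/-- All complex eigenvalues lie in the open unit disc. -/
def IsStable {ι : Type*} [Fintype ι] [DecidableEq ι] (A : Matrix ι ι ℝ) : Prop :=
  ∀ z ∈ spectrum ℂ (A.map (algebraMap ℝ ℂ)), ‖z‖ < 1

/-- The state `x(t)` for the initial state `x₀` and the input `u`. -/
def System.state {ι : Type*} [Fintype ι] (S : System ι) (x₀ : ι → ℝ) (u : ℕ → ℝ) : ℕ → ι → ℝ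
  | 0 => x₀
  | t + 1 => S.A *ᵥ S.state x₀ u t + u t • S.b

/-- The output `y(t)` for the initial state `x₀` and the input `u`. -/
def System.output {ι : Type*} [Fintype ι] (S : System ι) (x₀ : ι → ℝ) (u : ℕ → ℝ) (t : ℕ) : ℝ :=
  S.c ⬝ᵥ S.state x₀ u t

/-- Internal positivity: nonnegative inputs and initial states give nonnegative states and
outputs. -/
def System.IsInternallyPositive {ι : Type*} [Fintype ι] (S : System ι) : Prop :=
  ∀ (x₀ : ι → ℝ) (u : ℕ → ℝ), (∀ i, 0 ≤ x₀ i) → (∀ t, 0 ≤ u t) →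
    (∀ t, 0 ≤ S.output x₀ u t) ∧ ∀ t i, 0 ≤ S.state x₀ u t i

/-- The controllability operator `u ↦ x(0) = ∑_{t ≤ -1} A^{-t-1} b u(t)`. Past inputs are listed
backwards from time `-1`: `u s` is the input at time `-1 - s`. For stable `A` and bounded `u` the
series converges. -/
def System.conOp {n : ℕ} (S : System (Fin n)) (u : ℕ → ℝ) : Fin n → ℝ :=
  ∑' s : ℕ, u s • (S.A ^ s *ᵥ S.b)

/-- The observability operator `x₀ ↦ (c A^t x₀)_{t ≥ 0}`. -/
def System.obsOp {n : ℕ} (S : System (Fin n)) (x₀ : Fin n → ℝ) : ℕ → ℝ :=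
  fun t => S.c ⬝ᵥ (S.A ^ t *ᵥ x₀)

/-- Internal Hankel `k`-positivity (`k = ⊤`: internal Hankel total positivity). The controllability
operator acts on bounded past inputs. -/
def System.IsInternallyHankelPos {n : ℕ} (k : ℕ∞) (S : System (Fin n)) : Prop :=
  IsOVD (k - 1) Set.univ (fun x : Fin n → ℝ => S.A *ᵥ x) ∧
  IsOVD (k - 1) {u : ℕ → ℝ | ∃ M : ℝ, ∀ s, |u s| ≤ M} S.conOp ∧
  IsOVD (k - 1) Set.univ S.obsOp

/-- The `r`-th multiplicative compound matrix: the matrix of all `r`-minors. An `r`-element subset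
of the row (column) indices is given by its increasing enumeration. -/
def compound {n m : ℕ} (r : ℕ) (X : Matrix (Fin n) (Fin m) ℝ) :
    Matrix (Fin r ↪o Fin n) (Fin r ↪o Fin m) ℝ :=
  Matrix.of fun I J => (X.submatrix I J).det

/-- The truncated controllability matrix `(b, A b, …, A^{j-1} b)`. -/
def conMat {n : ℕ} (j : ℕ) (A : Matrix (Fin n) (Fin n) ℝ) (b : Fin n → ℝ) :
    Matrix (Fin n) (Fin j) ℝ :=
  Matrix.of fun i t => (A ^ (t : ℕ) *ᵥ b) i

/-- The truncated observability matrix, with rows `c, c A, …, c A^{j-1}`. -/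
def obsMat {n : ℕ} (j : ℕ) (A : Matrix (Fin n) (Fin n) ℝ) (c : Fin n → ℝ) :
    Matrix (Fin j) (Fin n) ℝ :=
  (conMat j Aᵀ c)ᵀ

/-- The only `j`-element subset of `j` indices. -/
def fullSet (j : ℕ) : Fin j ↪o Fin j := RelEmbedding.refl _

/-- The realization of the `j`-th compound system. Its input matrix, the `j`-th compound of an
`n × j` matrix, is a single column, and its output matrix is a single row. -/
def System.compoundSystem {n : ℕ} (S : System (Fin n)) (j : ℕ) : System (Fin j ↪o Fin n) where
  A := compound j S.A
  b := fun I => compound j (conMat j S.A S.b) I (fullSet j)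
  c := fun I => compound j (obsMat j S.A S.c) (fullSet j) I

end

end HankelPos

/-!
The three maps of internal Hankel `k`-positivity are given by the matrices `A`, the infinite
controllability matrix `(b, A b, A² b, …)` and the transpose of the infinite controllability matrix
of `(Aᵀ, cᵀ)`. The proof has two halves.

*Variation diminishment is nonnegativity of minors*, for any, possibly infinite, matrix. A negative
minor of least order `j ≤ k` maps the vector formed from its adjugate, which alternates, to one
alternating in the opposite sense, which the sign clause forbids (`minorsNonneg_of_isOVD`).
Conversely, let `u` consist of `v + 1` blocks of constant sign with `v + 1 ≤ k`. If `X u` had an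
alternating subsequence of length `v + 1` starting with the wrong sign, then the square matrix
obtained from those rows by summing the columns over the blocks would become singular after the
addition of a positive diagonal matrix. But its principal minors are nonnegative, so that this sum
has positive determinant (`det_add_diagonal_pos`, `not_opposite_alternating_sum`). No approximation
by strictly totally positive matrices is needed here. Bounded infinite inputs are handled by
truncation: a wrong pattern consists of finitely many strict inequalities and survives in the
partial sums, which converge because `A` is stable (`isOVD_of_minorsNonneg`).

*Finitely many columns suffice*: if `A` and the truncated controllability matrices have nonnegative
minors up to order `k`, so has the infinite controllability matrix (`minorsNonneg_krylovMatrix`).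
By Cauchy–Binet this is clear for consecutive columns `t, …, t + j - 1`. Multiplying on the left by
a scaled Cauchy kernel, which has positive minors and tends to the identity, makes such minors
positive unless the columns are dependent, and in that case any `j` columns from `t` on are
dependent, since they lie in a Krylov space of dimension less than `j`
(`exists_krylov_relation`). Under this dichotomy the three-term Plücker relation reduces arbitrary
columns to consecutive ones (`minorsNonneg_of_consecutive`).

Finally, the compound systems are internally positive exactly when their matrices are entrywise
nonnegative (`System.isInternallyPositive_iff`).
-/

namespace HankelPos

/-! ### Sign changes and alternating subsequences -/

section Variation

variable {ι : Type*} [LinearOrder ι]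

/-- The sign changes of `u`: pairs of positions carrying opposite signs with only zeros in
between. -/
def signChanges (u : ι → ℝ) : Set (ι × ι) :=
  {p | p.1 < p.2 ∧ u p.1 * u p.2 < 0 ∧ ∀ l, p.1 < l → l < p.2 → u l = 0}

/-- The number of sign changes of `u` completed at or before position `i`. -/
noncomputable def changeCount (u : ι → ℝ) (i : ι) : ℕ :=
  (signChanges u ∩ {p | p.2 ≤ i}).ncard

lemma snd_ne_zero_of_mem_signChanges {u : ι → ℝ} {p : ι × ι} (hp : p ∈ signChanges u) :
    u p.2 ≠ 0 := by
  intro h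
  have := hp.2.1
  simp [h] at this

lemma fst_ne_zero_of_mem_signChanges {u : ι → ℝ} {p : ι × ι} (hp : p ∈ signChanges u) :
    u p.1 ≠ 0 := by
  intro h
  have := hp.2.1
  simp [h] at this

/-- A sign change is determined by its second position. -/
lemma signChanges_injOn_snd (u : ι → ℝ) : Set.InjOn Prod.snd (signChanges u) := by
  rintro ⟨a, b⟩ hp ⟨c, d⟩ hq (rfl : b = d)
  rcases lt_trichotomy a c with h | rfl | h
  · exact absurd (hp.2.2 c h hq.1) (fst_ne_zero_of_mem_signChanges hq)
  · rfl
  · exact absurd (hq.2.2 a h hp.1) (fst_ne_zero_of_mem_signChanges hp)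

lemma le_fst_of_snd_lt_snd {u : ι → ℝ} {p q : ι × ι} (hp : p ∈ signChanges u)
    (hq : q ∈ signChanges u) (h : p.2 < q.2) : p.2 ≤ q.1 := by
  by_contra! hlt
  exact snd_ne_zero_of_mem_signChanges hp (hq.2.2 _ hlt h)

lemma finite_signChanges_le [LocallyFiniteOrderBot ι] (u : ι → ℝ) (i : ι) :
    (signChanges u ∩ {p | p.2 ≤ i}).Finite := by
  refine ((Set.finite_Iic i).prod (Set.finite_Iic i)).subset ?_
  rintro ⟨a, b⟩ ⟨hp, hb⟩
  exact ⟨hp.1.le.trans hb, hb⟩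

lemma changeCount_mono [LocallyFiniteOrderBot ι] (u : ι → ℝ) : Monotone (changeCount u) := by
  intro i j hij
  exact Set.ncard_le_ncard (fun p hp => ⟨hp.1, le_trans hp.2 hij⟩) (finite_signChanges_le u j)

lemma changeCount_of_isFirstNonzero {u : ι → ℝ} {i : ι} (hi : IsFirstNonzero u i) :
    changeCount u i = 0 := by
  have : signChanges u ∩ {p | p.2 ≤ i} = ∅ := by
    ext p
    simp only [Set.mem_inter_iff, Set.mem_ofPred_eq, Set.mem_empty_iff_false, iff_false, not_and]
    intro hp hle
    exact fst_ne_zero_of_mem_signChanges hp (hi.2 _ (hp.1.trans_le hle))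
  simp [changeCount, this]

lemma changeCount_of_mem [LocallyFiniteOrderBot ι] {u : ι → ℝ} {l i : ι}
    (h : (l, i) ∈ signChanges u) : changeCount u i = changeCount u l + 1 := by
  have : signChanges u ∩ {p | p.2 ≤ i} = insert (l, i) (signChanges u ∩ {p | p.2 ≤ l}) := by
    ext p
    simp only [Set.mem_inter_iff, Set.mem_ofPred_eq, Set.mem_insert_iff]
    constructor
    · rintro ⟨hp, hle⟩
      rcases hle.lt_or_eq with hlt | heq
      · exact Or.inr ⟨hp, le_fst_of_snd_lt_snd hp h hlt⟩
      · exact Or.inl (signChanges_injOn_snd u hp h heq)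
    · rintro (rfl | ⟨hp, hle⟩)
      · exact ⟨h, le_rfl⟩
      · exact ⟨hp, hle.trans h.1.le⟩
  rw [changeCount, this, Set.ncard_insert_of_notMem _ (finite_signChanges_le u l), changeCount]
  rintro ⟨-, hle⟩
  exact absurd h.1 (not_lt.mpr hle)

lemma changeCount_eq_of_mul_pos {u : ι → ℝ} {l i : ι} (hli : l < i) (hpos : 0 < u l * u i)
    (h : ∀ m, l < m → m < i → u m = 0) : changeCount u i = changeCount u l := by
  have : signChanges u ∩ {p | p.2 ≤ i} = signChanges u ∩ {p | p.2 ≤ l} := by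
    ext p
    simp only [Set.mem_inter_iff, Set.mem_ofPred_eq]
    refine ⟨fun ⟨hp, hle⟩ => ⟨hp, ?_⟩, fun ⟨hp, hle⟩ => ⟨hp, hle.trans hli.le⟩⟩
    by_contra! hlt
    rcases hle.lt_or_eq with hlt' | heq
    · exact snd_ne_zero_of_mem_signChanges hp (h _ hlt hlt')
    · have h1 : p.1 = l := by
        rcases lt_trichotomy p.1 l with h2 | h2 | h2
        · have := hp.2.2 l h2 hlt
          simp [this] at hpos
        · exact h2
        · exact absurd (h _ h2 (heq ▸ hp.1)) (fst_ne_zero_of_mem_signChanges hp)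
      have := hp.2.1
      rw [heq, h1] at this
      exact absurd this (not_lt.mpr hpos.le)
  rw [changeCount, this, changeCount]

lemma exists_isFirstNonzero [WellFoundedLT ι] {u : ι → ℝ} (hu : u ≠ 0) :
    ∃ i, IsFirstNonzero u i := by
  obtain ⟨i, hi⟩ := Function.ne_iff.mp hu
  obtain ⟨m, hm, hmin⟩ := (wellFounded_lt (α := ι)).has_min {i | u i ≠ 0} ⟨i, hi⟩
  refine ⟨m, hm, fun l hl => ?_⟩
  by_contra hne
  exact hmin l hne hl

/-- The last nonzero entry strictly before `i`. -/
lemma exists_last_nonzero [LocallyFiniteOrderBot ι] {u : ι → ℝ} {i₀ i : ι} (h₀ : u i₀ ≠ 0)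
    (hi : i₀ < i) : ∃ l, i₀ ≤ l ∧ l < i ∧ u l ≠ 0 ∧ ∀ m, l < m → m < i → u m = 0 := by
  classical
  set s := (Finset.Iio i).filter (fun l => u l ≠ 0)
  have hs : i₀ ∈ s := by simp [s, hi, h₀]
  obtain ⟨l, hl, hmax⟩ := s.exists_max_image id ⟨i₀, hs⟩
  have hl' : l < i ∧ u l ≠ 0 := by simpa [s] using hl
  refine ⟨l, hmax _ hs, hl'.1, hl'.2, fun m hlm hmi => ?_⟩
  by_contra hne
  exact absurd (hmax m (by simp [s, hmi, hne])) (not_le.mpr hlm)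

/-- The sign of a nonzero entry, relative to the first nonzero entry, is given by the parity of the
number of preceding sign changes, and this number is the length of an alternating subsequence. -/
lemma sign_changeCount [LocallyFiniteOrderBot ι] [WellFoundedLT ι] {u : ι → ℝ} {i₀ : ι}
    (h₀ : IsFirstNonzero u i₀) (i : ι) (hi : u i ≠ 0) :
    0 < u i₀ * (-1) ^ changeCount u i * u i ∧
      ∃ f : Fin (changeCount u i + 1) → ι, StrictMono f ∧ f (Fin.last _) ≤ i ∧
        ∀ r : Fin _, 0 < u i₀ * (-1) ^ (r : ℕ) * u (f r) := by
  induction i using WellFoundedLT.induction with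
  | ind i ih =>
  rcases lt_trichotomy i i₀ with hlt | rfl | hlt
  · exact absurd (h₀.2 i hlt) hi
  · have h : 0 < u i * u i := mul_self_pos.mpr hi
    refine ⟨by simpa [changeCount_of_isFirstNonzero h₀] using h, ?_⟩
    rw [changeCount_of_isFirstNonzero h₀]
    refine ⟨fun _ => i, fun a b hab => absurd hab (by omega), le_rfl, fun r => ?_⟩
    have : (r : ℕ) = 0 := by omega
    simpa [this] using h
  · obtain ⟨l, hl0, hli, hul, hz⟩ := exists_last_nonzero h₀.1 hlt
    obtain ⟨hsgn, f, hf, hfl, hfs⟩ := ih l hli hul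
    rcases lt_or_gt_of_ne (mul_ne_zero hul hi) with hneg | hpos
    · have hc := changeCount_of_mem (u := u) (l := l) (i := i) ⟨hli, hneg, hz⟩
      have key : 0 < u i₀ * (-1) ^ (changeCount u l + 1) * u i := by
        have h1 : u i₀ * (-1) ^ (changeCount u l + 1) * u i * (u l * u l) =
          (u i₀ * (-1) ^ changeCount u l * u l) * (-(u l * u i)) := by ring
        have h2 : 0 < u l * u l := mul_self_pos.mpr hul
        have h3 := mul_pos hsgn (neg_pos.mpr hneg)
        rw [← h1] at h3
        exact pos_of_mul_pos_left h3 h2.le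
      refine ⟨hc ▸ key, ?_⟩
      rw [hc]
      refine ⟨Fin.snoc f i, ?_, by simp, fun r => ?_⟩
      · rw [Fin.strictMono_iff_lt_succ]
        intro r
        induction r using Fin.lastCases with
        | last => simpa using hfl.trans_lt hli
        | cast r =>
          rw [← Fin.castSucc_succ, Fin.snoc_castSucc (α := fun _ => ι),
            Fin.snoc_castSucc (α := fun _ => ι)]
          exact hf Fin.castSucc_lt_succ
      · induction r using Fin.lastCases with
        | last => simpa using key
        | cast r => simpa using hfs r
    · have hc := changeCount_eq_of_mul_pos hli hpos hz
      refine ⟨?_, ?_⟩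
      · rw [hc]
        have h1 : u i₀ * (-1) ^ (changeCount u l) * u i * (u l * u l) =
          (u i₀ * (-1) ^ changeCount u l * u l) * (u l * u i) := by ring
        have h2 : 0 < u l * u l := mul_self_pos.mpr hul
        have h3 := mul_pos hsgn hpos
        rw [← h1] at h3
        exact pos_of_mul_pos_left h3 h2.le
      · rw [hc]
        exact ⟨f, hf, hfl.trans hli.le, hfs⟩

lemma exists_le_changeCount [LocallyFiniteOrderBot ι] {u : ι → ℝ} {m : ℕ} (hm : 1 ≤ m)
    (h : (m : ℕ∞) ≤ variation u) : ∃ i, u i ≠ 0 ∧ m ≤ changeCount u i := by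
  obtain ⟨t, ht, htm⟩ := Set.exists_subset_encard_eq (s := signChanges u) h
  have hfin : t.Finite := Set.finite_of_encard_eq_coe htm
  have hne : t.Nonempty := by
    rw [← Set.encard_pos, htm]
    exact_mod_cast hm
  obtain ⟨p, hp, hmax⟩ := Set.exists_max_image t Prod.snd hfin hne
  refine ⟨p.2, snd_ne_zero_of_mem_signChanges (ht hp), ?_⟩
  have h1 : t.ncard = m := by rw [Set.ncard, htm]; rfl
  rw [← h1]
  exact Set.ncard_le_ncard (fun q hq => ⟨ht hq, hmax q hq⟩) (finite_signChanges_le u _)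

lemma changeCount_le_variation [LocallyFiniteOrderBot ι] (u : ι → ℝ) (i : ι) :
    (changeCount u i : ℕ∞) ≤ variation u := by
  rw [changeCount, (finite_signChanges_le u i).cast_ncard_eq]
  exact Set.encard_le_encard Set.inter_subset_left

/-- A vector of variation at least `m` has an alternating subsequence with `m` sign changes that
starts with the sign of the first nonzero entry. -/
lemma exists_alternating [LocallyFiniteOrderBot ι] [WellFoundedLT ι] {u : ι → ℝ} {i₀ : ι} {m : ℕ}
    (h₀ : IsFirstNonzero u i₀) (h : (m : ℕ∞) ≤ variation u) :
    ∃ f : Fin (m + 1) → ι, StrictMono f ∧ ∀ r : Fin _, 0 < u i₀ * (-1) ^ (r : ℕ) * u (f r) := by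
  obtain ⟨i, hi, hmi⟩ : ∃ i, u i ≠ 0 ∧ m ≤ changeCount u i := by
    rcases Nat.eq_zero_or_pos m with rfl | hm
    · exact ⟨i₀, h₀.1, Nat.zero_le _⟩
    · exact exists_le_changeCount hm h
  obtain ⟨-, f, hf, -, hfs⟩ := sign_changeCount h₀ i hi
  exact ⟨f ∘ Fin.castLE (by omega), hf.comp (Fin.strictMono_castLE _), fun r => hfs (Fin.castLE _ r)⟩

/-- A vector of variation `v` splits into `v + 1` successive blocks of alternating sign. -/
lemma exists_blocks [LocallyFiniteOrderBot ι] [WellFoundedLT ι] {u : ι → ℝ} {i₀ : ι} {v : ℕ}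
    (h₀ : IsFirstNonzero u i₀) (h : variation u ≤ v) :
    ∃ β : ι → Fin (v + 1), Monotone β ∧ ∀ i, 0 ≤ u i₀ * (-1) ^ (β i : ℕ) * u i := by
  have hle : ∀ i, changeCount u i < v + 1 := fun i => by
    have := (changeCount_le_variation u i).trans h
    exact Nat.lt_succ_of_le (by exact_mod_cast this)
  refine ⟨fun i => ⟨changeCount u i, hle i⟩, fun i j hij => changeCount_mono u hij, fun i => ?_⟩
  by_cases hi : u i = 0
  · simp [hi]
  · exact (sign_changeCount h₀ i hi).1.le

/-- A vector that splits into `v + 1` successive blocks of alternating sign has variation at most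
`v`. -/
lemma variation_le_of_blocks {u : ι → ℝ} {v : ℕ} {σ : ℝ} (hσ : σ ≠ 0) (β : ι → Fin (v + 1))
    (hβ : Monotone β) (h : ∀ i, 0 ≤ σ * (-1) ^ (β i : ℕ) * u i) : variation u ≤ v := by
  -- the block number increases strictly across a sign change
  have hlt : ∀ p ∈ signChanges u, β p.1 < β p.2 := by
    intro p hp
    refine lt_of_le_of_ne (hβ hp.1.le) fun heq => ?_
    have h1 := mul_nonneg (h p.1) (h p.2)
    rw [heq] at h1
    have h2 : σ * (-1) ^ (β p.2 : ℕ) * u p.1 * (σ * (-1) ^ (β p.2 : ℕ) * u p.2) =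
        (σ * (-1) ^ (β p.2 : ℕ)) ^ 2 * (u p.1 * u p.2) := by ring
    rw [h2] at h1
    have h3 : 0 < (σ * (-1) ^ (β p.2 : ℕ)) ^ 2 := by positivity
    exact absurd (mul_neg_of_pos_of_neg h3 hp.2.1) (not_lt.mpr h1)
  have hmaps : Set.MapsTo (fun p : ι × ι => β p.2) (signChanges u) (Set.Ioi 0) := fun p hp =>
    lt_of_le_of_lt (Fin.zero_le _) (hlt p hp)
  have hinj : Set.InjOn (fun p : ι × ι => β p.2) (signChanges u) := by
    intro p hp q hq hpq
    by_contra hne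
    have hne2 : p.2 ≠ q.2 := fun h2 => hne (signChanges_injOn_snd u hp hq h2)
    rcases lt_or_gt_of_ne hne2 with h2 | h2
    · exact absurd hpq ((hβ (le_fst_of_snd_lt_snd hp hq h2)).trans_lt (hlt q hq)).ne
    · exact absurd hpq ((hβ (le_fst_of_snd_lt_snd hq hp h2)).trans_lt (hlt p hp)).ne'
  calc variation u = (signChanges u).encard := rfl
    _ ≤ (Set.Ioi (0 : Fin (v + 1))).encard := Set.encard_le_encard_of_injOn hmaps hinj
    _ = v := by
      rw [← Finset.coe_Ioi, Set.encard_coe_eq_coe_finsetCard]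
      simp

lemma exists_of_ne_zero_of_pos [WellFoundedLT ι] {u : ι → ℝ} {i : ι} {c : ℝ} (h : 0 < c * u i) :
    ∃ i₀, IsFirstNonzero u i₀ :=
  exists_isFirstNonzero fun h0 => by simp [h0] at h

/-- An alternating subsequence with `m` sign changes forces variation at least `m`. -/
lemma le_variation_of_alternating [LocallyFiniteOrderBot ι] [WellFoundedLT ι] {u : ι → ℝ} {m : ℕ}
    {σ : ℝ} (f : Fin (m + 1) → ι) (hf : StrictMono f)
    (h : ∀ r : Fin _, 0 < σ * (-1) ^ (r : ℕ) * u (f r)) : (m : ℕ∞) ≤ variation u := by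
  by_contra! hlt
  obtain ⟨v, hv⟩ := ENat.ne_top_iff_exists.mp (hlt.trans_le le_top).ne
  rw [← hv] at hlt
  have hvm : v < m := by exact_mod_cast hlt
  obtain ⟨i₀, h₀⟩ := exists_of_ne_zero_of_pos (h 0)
  obtain ⟨β, hβ, hs⟩ := exists_blocks h₀ hv.ge
  have hmono : StrictMono (β ∘ f) := by
    rw [Fin.strictMono_iff_lt_succ]
    intro r
    refine lt_of_le_of_ne (hβ (hf Fin.castSucc_lt_succ).le) fun heq => ?_
    simp only [Function.comp_apply] at heq
    have h1 := h r.castSucc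
    have h2 := h r.succ
    have h3 := hs (f r.castSucc)
    have h4 := hs (f r.succ)
    rw [heq] at h3
    have h5 := mul_pos h1 h2
    have h6 := mul_nonneg h3 h4
    have e5 : σ * (-1) ^ (r.castSucc : ℕ) * u (f r.castSucc) *
        (σ * (-1) ^ (r.succ : ℕ) * u (f r.succ)) =
        -((σ * (-1) ^ (r : ℕ)) ^ 2 * (u (f r.castSucc) * u (f r.succ))) := by
      simp only [Fin.val_castSucc, Fin.val_succ]; ring
    have e6 : u i₀ * (-1) ^ (β (f r.succ) : ℕ) * u (f r.castSucc) *
        (u i₀ * (-1) ^ (β (f r.succ) : ℕ) * u (f r.succ)) =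
        (u i₀ * (-1) ^ (β (f r.succ) : ℕ)) ^ 2 * (u (f r.castSucc) * u (f r.succ)) := by ring
    have h7 : 0 < (u i₀ * (-1) ^ (β (f r.succ) : ℕ)) ^ 2 := by
      have := h₀.1
      positivity
    rw [e5] at h5
    rw [e6] at h6
    have h8 := nonneg_of_mul_nonneg_right h6 h7
    have h9 := mul_nonneg (sq_nonneg (σ * (-1) ^ (r : ℕ))) h8
    linarith
  have := Fintype.card_le_of_injective _ hmono.injective
  simp at this
  omega

/-- An alternating subsequence that starts with the sign opposite to the first nonzero entry can
be extended by that entry. -/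
lemma lt_variation_of_alternating [LocallyFiniteOrderBot ι] [WellFoundedLT ι] {u : ι → ℝ} {m : ℕ}
    {i₀ : ι} (h₀ : IsFirstNonzero u i₀) (f : Fin (m + 1) → ι) (hf : StrictMono f)
    (h : ∀ r : Fin _, 0 < -u i₀ * (-1) ^ (r : ℕ) * u (f r)) : ((m + 1 : ℕ) : ℕ∞) ≤ variation u := by
  have hlt : i₀ < f 0 := by
    have h1 := h 0
    simp only [Fin.val_zero, pow_zero, mul_one, neg_mul] at h1
    rcases lt_trichotomy i₀ (f 0) with h2 | h2 | h2
    · exact h2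
    · rw [← h2] at h1
      exact absurd h1 (not_lt.mpr (neg_nonpos.mpr (mul_self_nonneg _)))
    · simp [h₀.2 _ h2] at h1
  refine le_variation_of_alternating (σ := u i₀) (Fin.cons i₀ f) ?_ fun r => ?_
  · rw [Fin.strictMono_cons]
    exact ⟨fun r => hlt.trans_le (hf.monotone (Fin.zero_le r)), hf⟩
  · refine Fin.cases ?_ (fun r => ?_) r
    · simpa using h₀.1
    · have := h r
      simp only [Fin.val_succ, Fin.cons_succ, pow_succ]
      linarith

end Variation

/-! ### Determinants: principal minors, Cauchy–Binet, the Cauchy kernel -/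

/-- If all principal minors of `X` are nonnegative, then adding a positive diagonal matrix gives a
positive determinant: the determinant expands into principal minors with positive weights. -/
lemma det_add_diagonal_pos {m : Type*} [Fintype m] [DecidableEq m] (X : Matrix m m ℝ) (d : m → ℝ)
    (hd : ∀ i, 0 < d i)
    (h : ∀ s : Finset m, 0 ≤ (X.submatrix (fun i : s => (i : m)) (fun i : s => (i : m))).det) :
    0 < (X + diagonal d).det := by
  set P : Finset m → Matrix m m ℝ := fun s => Matrix.of fun i j =>
    if i ∈ s then X i j else diagonal d i j with hP
  have hexp : (X + diagonal d).det = ∑ s : Finset m, (P s).det := by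
    refine ((detRowAlternating (R := ℝ) (n := m)).map_add_univ X (diagonal d)).trans
      (Finset.sum_congr rfl fun s _ => congrArg Matrix.det ?_)
    ext i j
    by_cases hi : i ∈ s <;> simp [hP, Finset.piecewise, hi]
  have hterm : ∀ s : Finset m, (P s).det =
      (X.submatrix (fun i : s => (i : m)) (fun i : s => (i : m))).det *
        ∏ i : {i // i ∉ s}, d i := by
    intro s
    have e1 : toSquareBlockProp (P s) (fun i => i ∈ s) =
        X.submatrix (fun i : s => (i : m)) (fun i : s => (i : m)) := by
      ext i j
      have hi : (i : m) ∈ s := i.2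
      simp [toSquareBlockProp, toBlock_apply, hP, hi]
    have e2 : toSquareBlockProp (P s) (fun i => i ∉ s) =
        diagonal fun i : {i // i ∉ s} => d i := by
      ext i j
      have hi : (i : m) ∉ s := i.2
      simp [toSquareBlockProp, toBlock_apply, hP, hi, diagonal_apply, Subtype.ext_iff]
    refine (twoBlockTriangular_det _ (fun i => i ∈ s) fun i hi j hj => ?_).trans ?_
    · have hne : i ≠ j := fun h => hi (h ▸ hj)
      simp [hP, hi, hne]
    · rw [e1, e2, det_diagonal]
      congr!
  rw [hexp]
  refine Finset.sum_pos' (fun s _ => ?_) ⟨∅, Finset.mem_univ _, ?_⟩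
  · rw [hterm]
    exact mul_nonneg (h s) (Finset.prod_nonneg fun i _ => (hd i).le)
  · rw [hterm, det_isEmpty, one_mul]
    exact Finset.prod_pos fun i _ => hd i

/-- A determinant whose columns are linear combinations expands multilinearly. -/
lemma det_sum_columns {m : ℕ} {κ ι : Type*} [DecidableEq ι] (M : Matrix κ ι ℝ) (f : Fin m → κ)
    (F : Fin m → Finset ι) (a : Fin m → ι → ℝ) :
    (Matrix.of fun r q : Fin m => ∑ s ∈ F q, a q s * M (f r) s).det =
      ∑ φ ∈ Fintype.piFinset F, (∏ q, a q (φ q)) * (M.submatrix f φ).det := by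
  have h1 : (Matrix.of fun r q : Fin m => ∑ s ∈ F q, a q s * M (f r) s)ᵀ =
      fun q => ∑ s ∈ F q, a q s • fun r => M (f r) s := by
    ext q r
    simp
  have h2 := (detRowAlternating (R := ℝ) (n := Fin m)).toMultilinearMap.map_sum_finset
    (fun q s => a q s • fun r => M (f r) s) F
  rw [← det_transpose, h1]
  refine h2.trans (Finset.sum_congr rfl fun φ _ => ?_)
  rw [MultilinearMap.map_smul_univ, smul_eq_mul, ← det_transpose (M.submatrix f φ)]
  rfl

/-- Injective maps from `Fin m` are exactly the increasing ones composed with permutations. -/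
lemma bijective_orderEmb_perm {m : ℕ} (ι : Type*) [LinearOrder ι] :
    Function.Bijective (fun p : (Fin m ↪o ι) × Equiv.Perm (Fin m) =>
      (⟨p.1 ∘ p.2, p.1.injective.comp p.2.injective⟩ : {φ : Fin m → ι // Function.Injective φ})) := by
  constructor
  · rintro ⟨I, σ⟩ ⟨J, τ⟩ h
    have h' : (I : Fin m → ι) ∘ σ = J ∘ τ := congrArg Subtype.val h
    have hr : Set.range I = Set.range J := by
      rw [← σ.surjective.range_comp I, h', τ.surjective.range_comp]
    have hIJ : I = J := OrderEmbedding.range_inj.mp hr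
    subst hIJ
    refine Prod.ext rfl (Equiv.ext fun i => I.injective (congrFun h' i))
  · rintro ⟨φ, hφ⟩
    have hmono : StrictMono (φ ∘ Tuple.sort φ) :=
      (Tuple.monotone_sort φ).strictMono_of_injective (hφ.comp (Tuple.sort φ).injective)
    refine ⟨(OrderEmbedding.ofStrictMono _ hmono, (Tuple.sort φ)⁻¹), Subtype.ext (funext fun i => ?_)⟩
    simp

/-- The Cauchy–Binet formula. -/
lemma det_mul_eq_sum {m : ℕ} {ι : Type*} [LinearOrder ι] [Fintype ι]
    (A : Matrix (Fin m) ι ℝ) (B : Matrix ι (Fin m) ℝ) :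
    (A * B).det = ∑ I : Fin m ↪o ι, (A.submatrix id I).det * (B.submatrix I id).det := by
  classical
  have h1 : (A * B).det = ∑ φ : Fin m → ι, (∏ q, B (φ q) q) * (A.submatrix id φ).det := by
    have := det_sum_columns A id (fun _ : Fin m => Finset.univ) (fun q s => B s q)
    rw [Fintype.piFinset_univ] at this
    rw [← this]
    congr 1
    ext r q
    simp [mul_apply, mul_comm]
  have h2 : ∑ φ : Fin m → ι, (∏ q, B (φ q) q) * (A.submatrix id φ).det =
      ∑ φ : {φ : Fin m → ι // Function.Injective φ},
        (∏ q, B (φ.1 q) q) * (A.submatrix id φ.1).det := by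
    rw [← Finset.sum_filter_of_ne (p := Function.Injective) (s := Finset.univ)]
    · exact Finset.sum_subtype _ (by simp) _
    · intro φ _ hne
      by_contra hφ
      obtain ⟨a, b, hab, hne'⟩ := Function.not_injective_iff.mp hφ
      refine hne ?_
      rw [det_zero_of_column_eq hne' (fun i => by simp [hab]), mul_zero]
  rw [h1, h2, ← (bijective_orderEmb_perm ι).sum_comp, Fintype.sum_prod_type]
  refine Finset.sum_congr rfl fun I _ => ?_
  rw [det_apply' (B.submatrix I id), Finset.mul_sum]
  refine Finset.sum_congr rfl fun σ _ => ?_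
  have : A.submatrix id (I ∘ σ) = (A.submatrix id I).submatrix id σ := rfl
  simp only [this, det_permute', submatrix_apply, id, Function.comp_apply]
  ring

/-- The determinant of a Cauchy matrix with increasing positive parameters is positive. -/
lemma det_cauchy_pos {m : ℕ} (x y : Fin m → ℝ) (hx : StrictMono x) (hy : StrictMono y)
    (hx0 : ∀ i, 0 < x i) (hy0 : ∀ i, 0 < y i) :
    0 < (Matrix.of fun i j => 1 / (x i + y j)).det := by
  induction m with
  | zero => simp
  | succ m ih =>
    have hpos : ∀ i j, x i + y j ≠ 0 := fun i j => (add_pos (hx0 i) (hy0 j)).ne'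
    -- clear the first column by subtracting multiples of the first row
    set B : Matrix (Fin (m + 1)) (Fin (m + 1)) ℝ := Matrix.of fun i j =>
      if i = 0 then 1 / (x 0 + y j) else
        ((x i - x 0) / (x i + y 0)) * (((y j - y 0) / (x 0 + y j)) * (1 / (x i + y j))) with hB
    have hdet : (Matrix.of fun i j => 1 / (x i + y j)).det = B.det := by
      refine det_eq_of_forall_row_eq_smul_add_const
        (fun i => if i = 0 then 0 else (x 0 + y 0) / (x i + y 0)) 0 (by simp) fun i j => ?_
      by_cases hi : i = 0
      · simp [hB, hi]
      · have h1 := hpos i j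
        have h2 := hpos i 0
        have h3 := hpos 0 j
        simp only [hB, of_apply, hi, if_false, if_true]
        field_simp
        ring
    have hB0 : ∀ i : Fin m, B i.succ 0 = 0 := fun i => by simp [hB]
    rw [hdet, det_succ_column_zero, Fin.sum_univ_succ]
    simp only [hB0, mul_zero, zero_mul, Finset.sum_const_zero, add_zero, Fin.val_zero, pow_zero,
      one_mul, Fin.succAbove_zero]
    have hsub : B.submatrix Fin.succ Fin.succ = Matrix.of fun i j : Fin m =>
        ((x i.succ - x 0) / (x i.succ + y 0)) * (Matrix.of fun i j : Fin m =>
          ((y j.succ - y 0) / (x 0 + y j.succ)) *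
            (Matrix.of fun i j : Fin m => 1 / (x i.succ + y j.succ)) i j) i j := by
      ext i j
      simp [hB]
    rw [hsub, det_mul_column, det_mul_row]
    have hfx : ∀ i : Fin m, 0 < (x i.succ - x 0) / (x i.succ + y 0) := fun i =>
      div_pos (sub_pos.mpr (hx (Fin.succ_pos i))) (add_pos (hx0 _) (hy0 _))
    have hfy : ∀ j : Fin m, 0 < (y j.succ - y 0) / (x 0 + y j.succ) := fun j =>
      div_pos (sub_pos.mpr (hy (Fin.succ_pos j))) (add_pos (hx0 _) (hy0 _))
    have h00 : 0 < B 0 0 := by simpa [hB] using add_pos (hx0 0) (hy0 0)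
    exact mul_pos h00 (mul_pos (Finset.prod_pos fun i _ => hfx i) (mul_pos
      (Finset.prod_pos fun i _ => hfy i) (ih _ _ (hx.comp Fin.strictMono_succ)
        (hy.comp Fin.strictMono_succ) (fun i => hx0 _) (fun i => hy0 _))))

/-- The symmetrically scaled Cauchy kernel `2 / (R ^ (i - j) + R ^ (j - i))`. All its minors are
positive, and it tends to the identity as `R → ∞`. -/
noncomputable def cauchyKernel (n : ℕ) (R : ℝ) : Matrix (Fin n) (Fin n) ℝ :=
  Matrix.of fun i j => (2 * R ^ (i : ℕ)) *
    (R ^ (j : ℕ) * (1 / ((R ^ 2) ^ (i : ℕ) + (R ^ 2) ^ (j : ℕ))))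

lemma det_cauchyKernel_submatrix_pos {n m : ℕ} {R : ℝ} (hR : 1 < R) (I J : Fin m ↪o Fin n) :
    0 < ((cauchyKernel n R).submatrix I J).det := by
  have h0 : 0 < R := zero_lt_one.trans hR
  have hmono : StrictMono fun i : Fin n => (R ^ 2) ^ (i : ℕ) := fun i j hij =>
    pow_lt_pow_right₀ (one_lt_pow₀ hR two_ne_zero) hij
  have hsub : (cauchyKernel n R).submatrix I J = Matrix.of fun i j : Fin m =>
      (2 * R ^ (I i : ℕ)) * (Matrix.of fun i j : Fin m => (R ^ (J j : ℕ)) *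
        (Matrix.of fun i j : Fin m => 1 / ((R ^ 2) ^ (I i : ℕ) + (R ^ 2) ^ (J j : ℕ))) i j) i j := by
    ext i j
    simp [cauchyKernel]
  rw [hsub, det_mul_column, det_mul_row]
  refine mul_pos (Finset.prod_pos fun i _ => by positivity)
    (mul_pos (Finset.prod_pos fun i _ => by positivity) ?_)
  exact det_cauchy_pos _ _ (hmono.comp I.strictMono) (hmono.comp J.strictMono)
    (fun i => by positivity) (fun i => by positivity)

open Filter Topology in
lemma tendsto_cauchyKernel (n : ℕ) : Tendsto (cauchyKernel n) atTop (𝓝 1) := by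
  refine tendsto_pi_nhds.mpr fun i => tendsto_pi_nhds.mpr fun j => ?_
  by_cases hij : i = j
  · subst hij
    refine tendsto_const_nhds.congr' ?_
    filter_upwards [eventually_gt_atTop 0] with R hR
    simp only [one_apply_eq, cauchyKernel, of_apply]
    field_simp
    ring
  · rw [one_apply_ne hij]
    have hlim : Tendsto (fun R : ℝ => 2 / R) atTop (𝓝 0) := tendsto_const_nhds.div_atTop tendsto_id
    have hne : (i : ℕ) ≠ j := fun h => hij (Fin.ext h)
    refine tendsto_of_tendsto_of_tendsto_of_le_of_le' tendsto_const_nhds hlim ?_ ?_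
    · filter_upwards [eventually_gt_atTop 0] with R hR
      simp only [cauchyKernel, of_apply]
      positivity
    · filter_upwards [eventually_ge_atTop 1] with R hR
      have hR0 : 0 < R := zero_lt_one.trans_le hR
      simp only [cauchyKernel, of_apply]
      have key : R ^ ((i : ℕ) + j + 1) ≤ (R ^ 2) ^ (i : ℕ) + (R ^ 2) ^ (j : ℕ) := by
        rw [← pow_mul, ← pow_mul]
        rcases lt_or_gt_of_ne hne with h | h
        · have := pow_le_pow_right₀ hR (show (i : ℕ) + j + 1 ≤ 2 * j by omega)
          have h2 : 0 < R ^ (2 * (i : ℕ)) := by positivity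
          linarith
        · have := pow_le_pow_right₀ hR (show (i : ℕ) + j + 1 ≤ 2 * i by omega)
          have h2 : 0 < R ^ (2 * (j : ℕ)) := by positivity
          linarith
      have e : 2 * R ^ (i : ℕ) * (R ^ (j : ℕ) * (1 / ((R ^ 2) ^ (i : ℕ) + (R ^ 2) ^ (j : ℕ)))) =
          2 * R ^ ((i : ℕ) + j) / ((R ^ 2) ^ (i : ℕ) + (R ^ 2) ^ (j : ℕ)) := by
        rw [pow_add]; ring
      rw [e, div_le_div_iff₀ (by positivity) hR0]
      calc 2 * R ^ ((i : ℕ) + j) * R = 2 * R ^ ((i : ℕ) + j + 1) := by ring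
        _ ≤ _ := by linarith

/-! ### Nonnegative minors and variation diminishment -/

section OVD

variable {ι κ : Type*} [LinearOrder ι] [LinearOrder κ]

/-- All minors of order at most `k` are nonnegative; the matrix may be infinite. -/
def MinorsNonneg (k : ℕ∞) (M : Matrix κ ι ℝ) : Prop :=
  ∀ j : ℕ, (j : ℕ∞) ≤ k → ∀ (I : Fin j ↪o κ) (J : Fin j ↪o ι), 0 ≤ (M.submatrix I J).det

/-- If `u` has `v + 1` blocks of alternating sign, then a finite combination of columns with
coefficients `u` has no alternating subsequence of length `v + 1` starting with the opposite sign.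
Summing columns over blocks gives a square matrix with nonnegative principal minors, and the
opposite signs would make it singular after adding a positive diagonal matrix. -/
lemma not_opposite_alternating_sum {k : ℕ∞} {M : Matrix κ ι ℝ} (hM : MinorsNonneg k M) {v : ℕ}
    (hv : ((v + 1 : ℕ) : ℕ∞) ≤ k) (F : Finset ι) {u : ι → ℝ} {σ : ℝ} {β : ι → Fin (v + 1)}
    (hβ : Monotone β) (hu : ∀ s, 0 ≤ σ * (-1) ^ (β s : ℕ) * u s)
    {f : Fin (v + 1) → κ} (hf : StrictMono f)
    (hneg : ∀ r : Fin (v + 1), σ * (-1) ^ (r : ℕ) * ∑ s ∈ F, u s * M (f r) s < 0) : False := by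
  set a : ι → ℝ := fun s => σ * (-1) ^ (β s : ℕ) * u s with ha
  set B : Fin (v + 1) → Finset ι := fun q => F.filter fun s => β s = q with hB
  set X : Matrix (Fin (v + 1)) (Fin (v + 1)) ℝ :=
    Matrix.of fun r q => ∑ s ∈ B q, a s * M (f r) s with hX
  set d : Fin (v + 1) → ℝ := fun r => -(σ * (-1) ^ (r : ℕ) * ∑ s ∈ F, u s * M (f r) s) with hd
  have hdet : 0 < (X + diagonal d).det := by
    refine det_add_diagonal_pos X d (fun r => neg_pos.mpr (hneg r)) fun S => ?_
    set e := S.orderIsoOfFin rfl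
    rw [← det_submatrix_equiv_self e.toEquiv]
    have h1 : (X.submatrix (fun i : S => (i : Fin (v + 1))) (fun i : S => (i : Fin (v + 1)))).submatrix
        e.toEquiv e.toEquiv = Matrix.of fun r q : Fin S.card =>
          ∑ s ∈ B (e q), a s * M (f (e r)) s := rfl
    rw [h1, det_sum_columns M (fun r => f (e r)) (fun q => B (e q)) (fun _ => a)]
    refine Finset.sum_nonneg fun φ hφ => mul_nonneg (Finset.prod_nonneg fun q _ => hu _) ?_
    have hβφ : ∀ q, β (φ q) = e q := fun q =>
      (Finset.mem_filter.mp (Fintype.mem_piFinset.mp hφ q)).2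
    have hφ' : StrictMono φ := fun q q' hqq => hβ.reflect_lt (by
      rw [hβφ, hβφ]
      exact e.strictMono hqq)
    have hfe : StrictMono fun r => f (e r) := fun q q' hqq => hf (e.strictMono hqq)
    have hcard : ((S.card : ℕ) : ℕ∞) ≤ k := by
      refine le_trans ?_ hv
      exact_mod_cast (Finset.card_le_univ S).trans (by simp)
    exact hM _ hcard (OrderEmbedding.ofStrictMono _ hfe) (OrderEmbedding.ofStrictMono _ hφ')
  have hsq : ∀ q : ℕ, ((-1 : ℝ) ^ q) * (-1) ^ q = 1 := fun q => by
    rw [← mul_pow]; simp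
  have hker : (X + diagonal d) *ᵥ (fun q => (-1 : ℝ) ^ (q : ℕ)) = 0 := by
    ext r
    rw [add_mulVec, Pi.add_apply, mulVec_diagonal, Pi.zero_apply]
    have h1 : (X *ᵥ fun q => (-1 : ℝ) ^ (q : ℕ)) r = σ * ∑ s ∈ F, u s * M (f r) s := by
      have hfib : ∑ q, ∑ s ∈ F with β s = q, u s * M (f r) s = ∑ s ∈ F, u s * M (f r) s :=
        Finset.sum_fiberwise F β _
      rw [← hfib, Finset.mul_sum, mulVec, dotProduct]
      refine Finset.sum_congr rfl fun q _ => ?_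
      simp only [hX, of_apply]
      rw [Finset.sum_mul, Finset.mul_sum]
      refine Finset.sum_congr rfl fun s hs => ?_
      have hq : β s = q := (Finset.mem_filter.mp hs).2
      simp only [ha, hq]
      linear_combination (σ * u s * M (f r) s) * hsq q
    rw [h1]
    simp only [hd]
    linear_combination (-(σ * ∑ s ∈ F, u s * M (f r) s)) * hsq r
  have h0 := eq_zero_of_mulVec_eq_zero hdet.ne' hker
  have := congrFun h0 0
  simp at this

open Filter Topology in
lemma not_opposite_alternating {k : ℕ∞} {M : Matrix κ ι ℝ} (hM : MinorsNonneg k M) {v : ℕ}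
    (hv : ((v + 1 : ℕ) : ℕ∞) ≤ k) {u : ι → ℝ} {y : κ → ℝ}
    (hy : ∀ i, HasSum (fun s => u s * M i s) (y i)) {σ : ℝ} {β : ι → Fin (v + 1)}
    (hβ : Monotone β) (hu : ∀ s, 0 ≤ σ * (-1) ^ (β s : ℕ) * u s)
    {f : Fin (v + 1) → κ} (hf : StrictMono f) :
    ¬ ∀ r : Fin (v + 1), σ * (-1) ^ (r : ℕ) * y (f r) < 0 := by
  intro hneg
  have hev : ∀ᶠ F : Finset ι in atTop, ∀ r : Fin (v + 1),
      σ * (-1) ^ (r : ℕ) * ∑ s ∈ F, u s * M (f r) s < 0 := by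
    rw [eventually_all]
    intro r
    exact ((hy (f r)).const_mul _).eventually_lt_const (hneg r)
  obtain ⟨F, hF⟩ := hev.exists
  exact not_opposite_alternating_sum hM hv F hβ hu hf hF

lemma variation_zero : variation (0 : ι → ℝ) = 0 := by
  simp [variation]

lemma variation_ne_top [Finite ι] (u : ι → ℝ) : variation u ≠ ⊤ :=
  Set.encard_ne_top_iff.mpr (Set.toFinite _)

/-- The blocks are cut at the support: position `s` lies in the block numbered by how many of
`J 1, …, J j` are at most `s`. -/
lemma variation_extend_le {j : ℕ} (J : Fin (j + 1) ↪o ι) {w : Fin (j + 1) → ℝ}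
    (hw : ∀ r : Fin (j + 1), 0 < (-1) ^ (r : ℕ) * w r) :
    variation (Function.extend J w 0) ≤ j := by
  have hcard : ∀ s, (Finset.univ.filter fun r : Fin j => J r.succ ≤ s).card < j + 1 := fun s =>
    Nat.lt_succ_of_le ((Finset.card_le_univ _).trans (by simp))
  refine variation_le_of_blocks one_ne_zero (fun s => ⟨_, hcard s⟩) (fun s t hst => ?_) fun s => ?_
  · rw [Fin.mk_le_mk]
    refine Finset.card_le_card fun r hr => ?_
    simp only [Finset.mem_filter, Finset.mem_univ, true_and] at hr ⊢
    exact hr.trans hst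
  · by_cases hs : ∃ q, J q = s
    · obtain ⟨q, rfl⟩ := hs
      rw [J.injective.extend_apply]
      have hq : (Finset.univ.filter fun r : Fin j => J r.succ ≤ J q).card = q := by
        have : (Finset.univ.filter fun r : Fin j => J r.succ ≤ J q) =
            Finset.univ.filter fun r : Fin j => (r : ℕ) < q := by
          ext r
          simp only [Finset.mem_filter, Finset.mem_univ, true_and, J.le_iff_le, Fin.le_def,
            Fin.val_succ]
          omega
        rw [this, Fin.card_filter_val_lt]
        omega
      simp only [hq]
      rw [one_mul]
      exact (hw q).le
    · rw [Function.extend_apply' _ _ _ hs]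
      simp

variable [LocallyFiniteOrderBot ι] [WellFoundedLT ι] [LocallyFiniteOrderBot κ] [WellFoundedLT κ]

lemma isOVD_of_minorsNonneg {k : ℕ∞} (hk : 1 ≤ k) {M : Matrix κ ι ℝ} (hM : MinorsNonneg k M)
    {D : Set (ι → ℝ)} {X : (ι → ℝ) → κ → ℝ}
    (hX : ∀ u ∈ D, ∀ i, HasSum (fun s => u s * M i s) (X u i)) (hfin : Finite ι ∨ Finite κ) :
    IsOVD (k - 1) D X := by
  intro u hu hvar
  by_cases htop : variation u = ⊤
  · refine ⟨htop ▸ le_top, fun heq => ?_⟩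
    rcases hfin with h | h
    · exact absurd htop (variation_ne_top u)
    · exact absurd (heq.trans htop) (variation_ne_top (X u))
  obtain ⟨v, hv⟩ := ENat.ne_top_iff_exists.mp htop
  have hvk : ((v + 1 : ℕ) : ℕ∞) ≤ k := by
    rw [← hv] at hvar
    calc ((v + 1 : ℕ) : ℕ∞) = v + 1 := by push_cast; rfl
      _ ≤ k - 1 + 1 := by gcongr
      _ = k := tsub_add_cancel_of_le hk
  by_cases hXu : X u = 0
  · rw [hXu, variation_zero]
    exact ⟨zero_le, fun _ i j _ hj => absurd rfl hj.1⟩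
  have hu0 : u ≠ 0 := by
    rintro rfl
    refine hXu (funext fun i => ?_)
    have := hX _ hu i
    simp only [Pi.zero_apply, zero_mul] at this
    exact this.unique hasSum_zero
  obtain ⟨i₀, hi₀⟩ := exists_isFirstNonzero hu0
  obtain ⟨j₀, hj₀⟩ := exists_isFirstNonzero hXu
  obtain ⟨β, hβ, hβu⟩ := exists_blocks hi₀ hv.ge
  have hno : ∀ f : Fin (v + 1) → κ, StrictMono f →
      ¬ ∀ r : Fin (v + 1), u i₀ * (-1) ^ (r : ℕ) * X u (f r) < 0 := fun f hf =>
    not_opposite_alternating hM hvk (hX u hu) hβ hβu hf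
  -- the sign of one factor can be exchanged for that of another of opposite sign
  have hswap : u i₀ * X u j₀ < 0 → ∀ x, 0 < X u j₀ * x → u i₀ * x < 0 := by
    intro h x hx
    have h1 := mul_neg_of_neg_of_pos h hx
    have h2 : u i₀ * X u j₀ * (X u j₀ * x) = (X u j₀ * X u j₀) * (u i₀ * x) := by ring
    rw [h2] at h1
    exact neg_of_mul_neg_right h1 (mul_self_nonneg _)
  have hkeep : 0 < u i₀ * X u j₀ → ∀ x, 0 < X u j₀ * x → 0 < u i₀ * x := by
    intro h x hx
    have h1 := mul_pos h hx
    have h2 : u i₀ * X u j₀ * (X u j₀ * x) = (X u j₀ * X u j₀) * (u i₀ * x) := by ring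
    rw [h2] at h1
    exact pos_of_mul_pos_right h1 (mul_self_nonneg _)
  have hle : variation (X u) ≤ variation u := by
    by_contra! hlt
    rw [← hv] at hlt
    have hle' : ((v + 1 : ℕ) : ℕ∞) ≤ variation (X u) := by
      push_cast
      exact Order.add_one_le_of_lt hlt
    obtain ⟨g, hg, hgs⟩ := exists_alternating hj₀ hle'
    rcases lt_or_gt_of_ne (mul_ne_zero hi₀.1 hj₀.1) with hneg | hpos
    · refine hno (g ∘ Fin.castSucc) (hg.comp Fin.strictMono_castSucc) fun r => ?_
      rw [mul_assoc]
      refine hswap hneg _ ?_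
      have := hgs r.castSucc
      rwa [mul_assoc] at this
    · refine hno (g ∘ Fin.succ) (hg.comp Fin.strictMono_succ) fun r => ?_
      have h1 := hgs r.succ
      rw [mul_assoc] at h1
      have h2 := hkeep hpos _ h1
      rw [Fin.val_succ, pow_succ] at h2
      simp only [Function.comp_apply]
      linarith
  refine ⟨hle, fun heq i j hi hj => ?_⟩
  have hi' : i = i₀ := by
    rcases lt_trichotomy i i₀ with h | h | h
    · exact absurd (hi₀.2 i h) hi.1
    · exact h
    · exact absurd (hi.2 i₀ h) hi₀.1
  have hj' : j = j₀ := by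
    rcases lt_trichotomy j j₀ with h | h | h
    · exact absurd (hj₀.2 j h) hj.1
    · exact h
    · exact absurd (hj.2 j₀ h) hj₀.1
  subst hi' hj'
  rcases lt_or_gt_of_ne (mul_ne_zero hi.1 hj.1) with hneg | hpos
  · obtain ⟨g, hg, hgs⟩ := exists_alternating hj (m := v) (heq.trans hv.symm).ge
    refine absurd (fun r => ?_) (hno g hg)
    have := hgs r
    rw [mul_assoc] at this ⊢
    exact hswap hneg _ this
  · rcases pos_and_pos_or_neg_and_neg_of_mul_pos hpos with ⟨h1, h2⟩ | ⟨h1, h2⟩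
    · rw [sign_pos h1, sign_pos h2]
    · rw [sign_neg h1, sign_neg h2]

/-- Variation diminishment forces nonnegative minors. A negative minor of least order would map the
alternating vector obtained from its adjugate to one alternating in the opposite sense. -/
lemma minorsNonneg_of_isOVD {k : ℕ∞} {M : Matrix κ ι ℝ} {D : Set (ι → ℝ)}
    {X : (ι → ℝ) → κ → ℝ} (hX : IsOVD (k - 1) D X)
    (hcol : ∀ (j : ℕ) (J : Fin j ↪o ι) (w : Fin j → ℝ), Function.extend J w 0 ∈ D ∧
      ∀ i, X (Function.extend J w 0) i = ∑ r, M i (J r) * w r) : MinorsNonneg k M := by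
  intro j
  induction j with
  | zero => intro _ I J; simp
  | succ j ih =>
  intro hjk I J
  by_contra! hneg
  set T := M.submatrix I J with hT
  have hjk' : (j : ℕ∞) ≤ k - 1 := by
    have h : ((j + 1 : ℕ) : ℕ∞) - ((1 : ℕ) : ℕ∞) ≤ k - 1 := tsub_le_tsub_right hjk 1
    rwa [← ENat.natCast_sub, Nat.add_sub_cancel] at h
  have hminor : ∀ i r : Fin (j + 1), 0 ≤ (T.submatrix i.succAbove r.succAbove).det := fun i r =>
    ih (le_trans (by exact_mod_cast Nat.le_succ j) hjk) ((Fin.succAboveOrderEmb i).trans I)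
      ((Fin.succAboveOrderEmb r).trans J)
  have hadj : ∀ i r : Fin (j + 1), (-1) ^ (r : ℕ) * (T.adjugate r i * (-1) ^ (i : ℕ)) =
      (T.submatrix i.succAbove r.succAbove).det := fun i r => by
    rw [adjugate_fin_succ_eq_det_submatrix, pow_add]
    have h1 : ((-1 : ℝ) ^ (i : ℕ)) * (-1) ^ (i : ℕ) = 1 := by rw [← mul_pow]; simp
    have h2 : ((-1 : ℝ) ^ (r : ℕ)) * (-1) ^ (r : ℕ) = 1 := by rw [← mul_pow]; simp
    linear_combination (T.submatrix i.succAbove r.succAbove).det *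
      ((-1 : ℝ) ^ (r : ℕ)) * (-1) ^ (r : ℕ) * h1 + (T.submatrix i.succAbove r.succAbove).det * h2
  set w : Fin (j + 1) → ℝ := T.adjugate *ᵥ fun i => (-1) ^ (i : ℕ) with hw
  have hwsum : ∀ r : Fin (j + 1), (-1) ^ (r : ℕ) * w r =
      ∑ i : Fin (j + 1), (T.submatrix i.succAbove r.succAbove).det := fun r => by
    simp only [hw, mulVec, dotProduct, Finset.mul_sum, hadj]
  have hwpos : ∀ r : Fin (j + 1), 0 < (-1) ^ (r : ℕ) * w r := fun r => by
    rw [hwsum]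
    refine lt_of_le_of_ne (Finset.sum_nonneg fun i _ => hminor i r) fun h0 => ?_
    have hz := (Finset.sum_eq_zero_iff_of_nonneg fun i _ => hminor i r).mp h0.symm
    have hrow : ∀ i, T.adjugate r i = 0 := fun i => by
      have := hadj i r
      rw [hz i (Finset.mem_univ i)] at this
      simpa using this
    have := congrFun (congrFun (adjugate_mul T) r) r
    simp only [mul_apply, hrow, zero_mul, Finset.sum_const_zero, Matrix.smul_apply, one_apply_eq,
      smul_eq_mul, mul_one] at this
    exact hneg.ne this.symm
  have hTw : T *ᵥ w = fun i : Fin (j + 1) => T.det * (-1) ^ (i : ℕ) := by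
    rw [hw, mulVec_mulVec, mul_adjugate, smul_mulVec, one_mulVec]
    rfl
  obtain ⟨hD, hXu⟩ := hcol (j + 1) J w
  set u := Function.extend J w 0 with hu
  have hXI : ∀ r, X u (I r) = T.det * (-1) ^ (r : ℕ) := fun r => by
    rw [hXu, ← congrFun hTw r]
    rfl
  have huJ : ∀ r, u (J r) = w r := fun r => J.injective.extend_apply _ _ _
  have hvar_le : variation u ≤ j := variation_extend_le J hwpos
  have hvar_ge : (j : ℕ∞) ≤ variation u :=
    le_variation_of_alternating (σ := 1) J J.strictMono fun r => by
      rw [one_mul, huJ]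
      exact hwpos r
  have hsq : ∀ q : ℕ, ((-1 : ℝ) ^ q) * (-1) ^ q = 1 := fun q => by
    rw [← mul_pow]; simp
  have hXvar_ge : (j : ℕ∞) ≤ variation (X u) :=
    le_variation_of_alternating (σ := T.det) I I.strictMono fun r => by
      rw [hXI]
      have : T.det * (-1) ^ (r : ℕ) * (T.det * (-1) ^ (r : ℕ)) = T.det * T.det := by
        linear_combination T.det * T.det * hsq r
      rw [this]
      exact mul_self_pos.mpr hneg.ne
  obtain ⟨hle, hsign⟩ := hX u hD (hvar_le.trans hjk')
  have heq : variation (X u) = variation u := le_antisymm hle (hvar_le.trans hXvar_ge)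
  have hw0 : 0 < w 0 := by simpa using hwpos 0
  have hfirst : IsFirstNonzero u (J 0) := by
    refine ⟨by rw [huJ]; exact hw0.ne', fun l hl => ?_⟩
    refine Function.extend_apply' _ _ _ ?_
    rintro ⟨q, rfl⟩
    exact absurd (J.lt_iff_lt.mp hl) (Fin.not_lt_zero q)
  obtain ⟨j₀, hj₀⟩ := exists_isFirstNonzero (u := X u) fun h => by
    have := hXI 0
    rw [h] at this
    simp at this
    exact hneg.ne this.symm
  have hs := hsign heq _ _ hfirst hj₀
  rw [huJ, sign_pos hw0, sign_eq_one_iff] at hs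
  have hbig := lt_variation_of_alternating hj₀ I I.strictMono fun r => by
    rw [hXI]
    have : -X u j₀ * (-1) ^ (r : ℕ) * (T.det * (-1) ^ (r : ℕ)) = X u j₀ * -T.det := by
      linear_combination (-X u j₀ * T.det) * hsq r
    rw [this]
    exact mul_pos hs (neg_pos.mpr hneg)
  have hcontra := hbig.trans (hle.trans hvar_le)
  have : j + 1 ≤ j := by exact_mod_cast hcontra
  omega

end OVD

/-! ### Nonnegativity of minors from minors with consecutive columns -/

section Fekete

variable {κ ι : Type*}

/-- Sorting the first column into position `p` changes a minor by `(-1) ^ p`. -/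
lemma det_submatrix_insertNth {m : ℕ} (Y : Matrix κ ι ℝ) (I : Fin (m + 1) → κ) (p : Fin (m + 1))
    (s : ι) (T : Fin m → ι) :
    (Y.submatrix I (p.insertNth s T : Fin (m + 1) → ι)).det =
      (-1) ^ (p : ℕ) * (Y.submatrix I (Fin.cons s T : Fin (m + 1) → ι)).det := by
  have h : Y.submatrix I (p.insertNth s T : Fin (m + 1) → ι) =
      (Y.submatrix I (Fin.cons s T : Fin (m + 1) → ι)).submatrix id p.cycleRange := by
    rw [← Fin.cons_comp_cycleRange]
    rfl
  rw [h, det_permute', Fin.sign_cycleRange]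
  push_cast
  rfl

lemma det_submatrix_snoc {m : ℕ} (Y : Matrix κ ι ℝ) (I : Fin (m + 1) → κ) (s : ι) (T : Fin m → ι) :
    (Y.submatrix I (Fin.snoc T s : Fin (m + 1) → ι)).det =
      (-1) ^ m * (Y.submatrix I (Fin.cons s T : Fin (m + 1) → ι)).det := by
  have h := det_submatrix_insertNth Y I (Fin.last m) s T
  rwa [Fin.insertNth_last', Fin.val_last] at h

lemma det_submatrix_cons_insertNth {m : ℕ} (Y : Matrix κ ι ℝ) (I : Fin (m + 2) → κ)
    (p : Fin (m + 1)) (a s : ι) (T : Fin m → ι) :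
    (Y.submatrix I (Fin.cons a (p.insertNth s T : Fin (m + 1) → ι) : Fin (m + 2) → ι)).det =
      (-1) ^ (p : ℕ) *
        (Y.submatrix I (Fin.cons a (Fin.cons s T : Fin (m + 1) → ι) : Fin (m + 2) → ι)).det := by
  have h1 := det_submatrix_insertNth Y I p.succ s (Fin.cons a T : Fin (m + 1) → ι)
  have h2 := det_submatrix_insertNth Y I (Fin.succ 0) s (Fin.cons a T : Fin (m + 1) → ι)
  rw [Fin.insertNth_succ_cons] at h1 h2
  rw [Fin.insertNth_zero'] at h2
  rw [h1, h2]
  simp only [Fin.val_succ, Fin.val_zero]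
  ring

/-- The three-term Plücker relation between minors of order `m + 2` and `m + 1` with `m` columns
`T` in common. -/
lemma plucker_three_term {m : ℕ} (Y : Matrix κ ι ℝ) (I : Fin (m + 2) → κ)
    (I' : Fin (m + 1) → Fin (m + 2)) (T : Fin m → ι) (x y s : ι) :
    (Y.submatrix (I ∘ I') (Fin.cons s T : Fin (m + 1) → ι)).det *
        (Y.submatrix I (Fin.cons x (Fin.cons y T : Fin (m + 1) → ι) : Fin (m + 2) → ι)).det =
      (Y.submatrix (I ∘ I') (Fin.cons x T : Fin (m + 1) → ι)).det *
        (Y.submatrix I (Fin.cons s (Fin.cons y T : Fin (m + 1) → ι) : Fin (m + 2) → ι)).det +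
      (Y.submatrix (I ∘ I') (Fin.cons y T : Fin (m + 1) → ι)).det *
        (Y.submatrix I (Fin.cons x (Fin.cons s T : Fin (m + 1) → ι) : Fin (m + 2) → ι)).det := by
  -- Laplace expansion along the first column makes the small minor linear in that column
  set cof : Fin (m + 1) → ℝ := fun r =>
    (-1) ^ (r : ℕ) * (Y.submatrix ((I ∘ I') ∘ r.succAbove) T).det with hcof
  have hL : ∀ z, (Y.submatrix (I ∘ I') (Fin.cons z T : Fin (m + 1) → ι)).det =
      ∑ r, Y (I (I' r)) z * cof r := fun z => by
    rw [det_succ_column_zero]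
    refine Finset.sum_congr rfl fun r _ => ?_
    have : (Y.submatrix (I ∘ I') (Fin.cons z T : Fin (m + 1) → ι)).submatrix r.succAbove Fin.succ =
        Y.submatrix ((I ∘ I') ∘ r.succAbove) T := by
      ext a b
      simp
    rw [this]
    simp only [submatrix_apply, Function.comp_apply, Fin.cons_zero, hcof]
    ring
  have hLT : ∀ q, ∑ r, Y (I (I' r)) (T q) * cof r = 0 := fun q => by
    rw [← hL]
    refine det_zero_of_column_eq (Fin.succ_ne_zero q).symm fun r => ?_
    simp
  set c : Fin (m + 2) → ι := Fin.cons x (Fin.cons y T : Fin (m + 1) → ι) with hc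
  set W := Y.submatrix I c with hW
  set b : Fin (m + 2) → ℝ := fun r => Y (I r) s with hb
  have hcr := mulVec_cramer W b
  have h0 : cramer W b 0 =
      (Y.submatrix I (Fin.cons s (Fin.cons y T : Fin (m + 1) → ι) : Fin (m + 2) → ι)).det := by
    rw [cramer_apply]
    congr 1
    ext r q
    refine Fin.cases ?_ (fun q => ?_) q
    · simp [hb]
    · simp [hW, hc]
  have h1 : cramer W b 1 =
      (Y.submatrix I (Fin.cons x (Fin.cons s T : Fin (m + 1) → ι) : Fin (m + 2) → ι)).det := by
    rw [cramer_apply]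
    congr 1
    ext r q
    refine Fin.cases ?_ (fun q => Fin.cases ?_ (fun q => ?_) q) q
    · simp [hW, hc]
    · simp [hb]
    · rw [updateCol_ne (by simp [Fin.ext_iff])]
      simp [hW, hc]
  have hrow : ∀ r, ∑ i, Y (I r) (c i) * cramer W b i = W.det * Y (I r) s := fun r =>
    congrFun hcr r
  have hsum : ∑ i, cramer W b i * ∑ r, Y (I (I' r)) (c i) * cof r =
      W.det * ∑ r, Y (I (I' r)) s * cof r := by
    have e : ∀ r, W.det * (Y (I (I' r)) s * cof r) =
        ∑ i, cramer W b i * (Y (I (I' r)) (c i) * cof r) := fun r => by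
      rw [← mul_assoc, ← hrow, Finset.sum_mul]
      exact Finset.sum_congr rfl fun i _ => by ring
    simp only [Finset.mul_sum]
    rw [Finset.sum_comm]
    exact (Finset.sum_congr rfl fun r _ => e r).symm
  rw [Fin.sum_univ_succ, Fin.sum_univ_succ fun i : Fin (m + 1) => cramer W b i.succ *
    ∑ r, Y (I (I' r)) (c i.succ) * cof r] at hsum
  have hz : ∀ q : Fin m, ∑ r, Y (I (I' r)) (c q.succ.succ) * cof r = 0 := fun q => by
    simpa [hc] using hLT q
  simp only [hz, mul_zero, Finset.sum_const_zero, add_zero, Fin.succ_zero_eq_one] at hsum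
  rw [h0, h1] at hsum
  have hc0 : c 0 = x := rfl
  have hc1 : c 1 = y := rfl
  rw [hc0, hc1] at hsum
  rw [hL, hL, hL]
  linarith

lemma exists_strictMono_insertNth [LinearOrder ι] {m : ℕ} {T : Fin m → ι} (hT : StrictMono T)
    {s : ι} (hs : ∀ i, T i ≠ s) :
    ∃ p : Fin (m + 1), StrictMono (p.insertNth s T : Fin (m + 1) → ι) := by
  classical
  obtain ⟨p, hp, hmax⟩ := (Finset.univ.filter fun q : Fin (m + 1) =>
    ∀ i : Fin m, i.castSucc < q → T i < s).exists_max_image id ⟨0, by simp⟩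
  have hp' : ∀ i : Fin m, i.castSucc < p → T i < s := by simpa using hp
  refine ⟨p, (Fin.strictMono_insertNth_iff p s T).mpr ⟨hT, hp', fun i hi => ?_⟩⟩
  refine lt_of_le_of_ne (not_lt.mp fun hlt => ?_) (hs i).symm
  have hmem : i.succ ∈ Finset.univ.filter fun q : Fin (m + 1) =>
      ∀ i : Fin m, i.castSucc < q → T i < s := by
    simp only [Finset.mem_filter, Finset.mem_univ, true_and]
    intro l hl
    exact (hT.monotone (by rwa [Fin.castSucc_lt_succ_iff] at hl)).trans_lt hlt
  have := hmax _ hmem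
  simp only [id] at this
  exact absurd (hi.trans_lt Fin.castSucc_lt_succ) (not_lt.mpr this)

lemma add_sub_le_of_strictMono {m : ℕ} {f : Fin m → ℕ} (hf : StrictMono f) {a b : Fin m}
    (hab : a ≤ b) : f a + (b - a) ≤ f b := by
  cases m with
  | zero => exact a.elim0
  | succ m =>
    have hmono : Monotone fun i : Fin (m + 1) => (f i : ℤ) - i := by
      rw [Fin.monotone_iff_le_succ]
      intro i
      have := hf (Fin.castSucc_lt_succ (i := i))
      simp only [Fin.val_castSucc, Fin.val_succ]
      push_cast
      omega
    have h1 := hmono hab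
    have h2 : (a : ℕ) ≤ b := hab
    simp only at h1
    omega

/-- Fekete's principle in a form that tolerates degeneracy. Suppose that for each order `j ≤ k` and
each starting column `t`, either all minors of order `j` with the consecutive columns
`t, …, t + j - 1` are positive, or all minors of order `j` with columns from `t` on vanish. Then
all minors of order at most `k` are nonnegative. The induction is on the order and on the spread of
the columns, which the Plücker relation reduces. -/
lemma minorsNonneg_of_consecutive [LinearOrder κ] {k : ℕ∞} {Y : Matrix κ ℕ ℝ}
    (H : ∀ j : ℕ, (j : ℕ∞) ≤ k → ∀ t : ℕ,
      (∀ I : Fin j ↪o κ, 0 < (Y.submatrix I (fun i : Fin j => t + i)).det) ∨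
      ∀ (I : Fin j ↪o κ) (J : Fin j ↪o ℕ), (∀ i, t ≤ J i) → (Y.submatrix I J).det = 0) :
    MinorsNonneg k Y := by
  intro j
  induction j with
  | zero => intro _ I J; simp
  | succ j ih =>
  intro hjk
  have ih := ih (le_trans (by exact_mod_cast Nat.le_succ j) hjk)
  suffices hmain : ∀ (N : ℕ) (I : Fin (j + 1) ↪o κ) (J : Fin (j + 1) ↪o ℕ),
      J (Fin.last j) < J 0 + N → 0 ≤ (Y.submatrix I J).det from
    fun I J => hmain (J (Fin.last j) + 1) I J (by omega)
  intro N
  induction N with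
  | zero =>
    intro I J h
    exact absurd h (not_lt.mpr (J.monotone (Fin.zero_le _)))
  | succ N ihN =>
  intro I J hspread
  by_cases hcons : J (Fin.last j) = J 0 + j
  · have hJ : (J : Fin (j + 1) → ℕ) = fun i : Fin (j + 1) => J 0 + i := by
      funext i
      have h1 := add_sub_le_of_strictMono J.strictMono (Fin.zero_le i)
      have h2 := add_sub_le_of_strictMono J.strictMono (Fin.le_last i)
      have h3 : (i : ℕ) < j + 1 := i.2
      simp only [Fin.val_zero, Fin.val_last] at h1 h2
      omega
    rcases H (j + 1) hjk (J 0) with h | h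
    · rw [hJ]
      exact (h I).le
    · exact (h I J fun i => J.monotone (Fin.zero_le i)).ge
  have hlast := add_sub_le_of_strictMono J.strictMono (Fin.zero_le (Fin.last j))
  simp only [Fin.val_zero, Fin.val_last] at hlast
  obtain ⟨m, rfl⟩ : ∃ m, j = m + 1 := by
    cases j with
    | zero => exact absurd rfl hcons
    | succ m => exact ⟨m, rfl⟩
  by_contra! hneg
  set t₁ := J 0 with ht₁
  set t₂ := J (Fin.last (m + 1)) with ht₂
  set T : Fin m → ℕ := fun i => J i.castSucc.succ with hTdef
  have hTmono : StrictMono T := fun a b hab =>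
    J.strictMono (Fin.succ_lt_succ_iff.mpr (Fin.castSucc_lt_castSucc_iff.mpr hab))
  have ht₁T : ∀ i, t₁ < T i := fun i => J.strictMono (Fin.succ_pos _)
  have hTt₂ : ∀ i, T i < t₂ := fun i => J.strictMono (by
    rw [← Fin.succ_last, Fin.succ_lt_succ_iff]
    exact Fin.castSucc_lt_last i)
  have hJtail : (fun i => J (Fin.succ i)) = (Fin.snoc T t₂ : Fin (m + 1) → ℕ) := by
    funext i
    refine Fin.lastCases ?_ (fun i => ?_) i
    · simp [ht₂]
    · simp [hTdef]
  have hJeq : (J : Fin (m + 2) → ℕ) = Fin.cons t₁ (Fin.snoc T t₂ : Fin (m + 1) → ℕ) := by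
    rw [← hJtail]
    funext i
    refine Fin.cases ?_ (fun i => ?_) i <;> simp [ht₁]
  -- a nonvanishing minor in the Laplace expansion along the first column
  obtain ⟨i₀, hi₀⟩ : ∃ i₀ : Fin (m + 2),
      (Y.submatrix (I ∘ i₀.succAbove) (Fin.snoc T t₂ : Fin (m + 1) → ℕ)).det ≠ 0 := by
    by_contra! hall
    refine hneg.ne ?_
    rw [det_succ_column_zero]
    refine Finset.sum_eq_zero fun i _ => ?_
    have : (Y.submatrix I J).submatrix i.succAbove Fin.succ =
        Y.submatrix (I ∘ i.succAbove) (Fin.snoc T t₂ : Fin (m + 1) → ℕ) := by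
      rw [← hJtail]
      rfl
    rw [this, hall, mul_zero]
  set I' : Fin (m + 1) ↪o κ := (Fin.succAboveOrderEmb i₀).trans I with hI'
  have hI'c : (I' : Fin (m + 1) → κ) = I ∘ i₀.succAbove := rfl
  rw [← hI'c] at hi₀
  set L : ℕ → ℝ := fun z => (Y.submatrix I' (Fin.cons z T : Fin (m + 1) → ℕ)).det with hL
  have hLt₂ : L t₂ ≠ 0 := by
    rw [det_submatrix_snoc] at hi₀
    exact right_ne_zero_of_mul hi₀
  have hmk : ((m + 1 : ℕ) : ℕ∞) ≤ k := le_trans (by exact_mod_cast Nat.le_succ _) hjk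
  have hZ : 0 < (Y.submatrix I' (fun i : Fin (m + 1) => t₁ + 1 + i)).det := by
    rcases H (m + 1) hmk (t₁ + 1) with h | h
    · exact h I'
    · refine absurd ?_ hi₀
      have hmono : StrictMono (Fin.snoc T t₂ : Fin (m + 1) → ℕ) := by
        rw [← hJtail]
        exact J.strictMono.comp Fin.strictMono_succ
      refine h I' (OrderEmbedding.ofStrictMono _ hmono) fun i => ?_
      change t₁ + 1 ≤ (Fin.snoc T t₂ : Fin (m + 1) → ℕ) i
      rw [← hJtail]
      exact J.strictMono (Fin.succ_pos i)
  -- the exchange step: some column in between completes `T` to an independent family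
  obtain ⟨s, hst₁, hst₂, hLs⟩ : ∃ s, t₁ < s ∧ s < t₂ ∧ L s ≠ 0 := by
    by_contra! hall
    set cof : Fin (m + 1) → ℝ := fun r =>
      (-1) ^ (r : ℕ) * (Y.submatrix (I' ∘ r.succAbove) T).det with hcof
    have hLc : ∀ z, L z = ∑ r, cof r * Y (I' r) z := fun z => by
      simp only [hL]
      rw [det_succ_column_zero]
      refine Finset.sum_congr rfl fun r _ => ?_
      have : (Y.submatrix I' (Fin.cons z T : Fin (m + 1) → ℕ)).submatrix r.succAbove Fin.succ =
          Y.submatrix (I' ∘ r.succAbove) T := by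
        ext a b
        simp
      rw [this]
      simp only [submatrix_apply, Fin.cons_zero, hcof]
      ring
    have hvec : cof ᵥ* Y.submatrix I' (fun i : Fin (m + 1) => t₁ + 1 + i) = 0 := by
      funext i
      have h2 : (i : ℕ) < m + 1 := i.2
      have := hall (t₁ + 1 + i) (by omega) (by omega)
      rw [hLc] at this
      exact this
    have hcof0 := eq_zero_of_vecMul_eq_zero hZ.ne' hvec
    refine hLt₂ ?_
    rw [hLc, hcof0]
    simp
  have hTs : ∀ i, T i ≠ s := fun i hi => hLs (by
    refine det_zero_of_column_eq (Fin.succ_ne_zero i).symm fun r => ?_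
    simp [hi])
  obtain ⟨p, hp⟩ := exists_strictMono_insertNth hTmono hTs
  set P : Fin (m + 1) → ℕ := p.insertNth s T with hP
  have hPgt : ∀ i, t₁ < P i := fun i => by
    refine Fin.succAboveCases p ?_ (fun i => ?_) i
    · simpa [hP] using hst₁
    · simpa [hP] using ht₁T i
  have hPlt : ∀ i, P i < t₂ := fun i => by
    refine Fin.succAboveCases p ?_ (fun i => ?_) i
    · simpa [hP] using hst₂
    · simpa [hP] using hTt₂ i
  have hsq : ∀ q : ℕ, ((-1 : ℝ) ^ q) * (-1) ^ q = 1 := fun q => by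
    rw [← mul_pow]; simp
  have hK₁ : StrictMono (Fin.snoc P t₂ : Fin (m + 2) → ℕ) := by
    rw [Fin.strictMono_iff_lt_succ]
    intro i
    refine Fin.lastCases ?_ (fun i => ?_) i
    · simpa using hPlt _
    · rw [← Fin.castSucc_succ, Fin.snoc_castSucc (α := fun _ => ℕ),
        Fin.snoc_castSucc (α := fun _ => ℕ)]
      exact hp Fin.castSucc_lt_succ
  have hK₂ : StrictMono (Fin.cons t₁ P : Fin (m + 2) → ℕ) := Fin.strictMono_cons.mpr ⟨hPgt, hp⟩
  have hT₁ : StrictMono (Fin.cons t₁ T : Fin (m + 1) → ℕ) :=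
    Fin.strictMono_cons.mpr ⟨ht₁T, hTmono⟩
  have hTsnoc : StrictMono (Fin.snoc T t₂ : Fin (m + 1) → ℕ) := by
    rw [← hJtail]
    exact J.strictMono.comp Fin.strictMono_succ
  -- the five sorted minors
  have e₁ : 0 ≤ (-1) ^ (p : ℕ) * L s := by
    have := ih I' (OrderEmbedding.ofStrictMono _ hp)
    rw [OrderEmbedding.coe_ofStrictMono, hP, det_submatrix_insertNth] at this
    exact this
  have e₂ : 0 ≤ L t₁ := ih I' (OrderEmbedding.ofStrictMono _ hT₁)
  have e₃ : 0 ≤ (-1) ^ m * L t₂ := by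
    have := ih I' (OrderEmbedding.ofStrictMono _ hTsnoc)
    rw [OrderEmbedding.coe_ofStrictMono, det_submatrix_snoc] at this
    exact this
  set E : ℕ → ℕ → ℝ := fun x y =>
    (Y.submatrix I (Fin.cons x (Fin.cons y T : Fin (m + 1) → ℕ) : Fin (m + 2) → ℕ)).det with hE
  have e₄ : 0 ≤ (-1) ^ (m + 1) * ((-1) ^ (p : ℕ) * E t₂ s) := by
    have := ihN I (OrderEmbedding.ofStrictMono _ hK₁) (by
      simp only [OrderEmbedding.coe_ofStrictMono, Fin.snoc_last]
      have h0 : (Fin.snoc P t₂ : Fin (m + 2) → ℕ) 0 = P 0 := by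
        rw [← Fin.castSucc_zero, Fin.snoc_castSucc (α := fun _ => ℕ)]
      rw [h0]
      have := hPgt 0
      omega)
    rw [OrderEmbedding.coe_ofStrictMono, det_submatrix_snoc, hP,
      det_submatrix_cons_insertNth] at this
    exact this
  have e₅ : 0 ≤ (-1) ^ (p : ℕ) * E t₁ s := by
    have := ihN I (OrderEmbedding.ofStrictMono _ hK₂) (by
      simp only [OrderEmbedding.coe_ofStrictMono, Fin.cons_zero]
      rw [← Fin.succ_last, Fin.cons_succ]
      have := hPlt (Fin.last m)
      omega)
    rw [OrderEmbedding.coe_ofStrictMono, hP, det_submatrix_cons_insertNth] at this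
    exact this
  have e₆ : (Y.submatrix I J).det = (-1) ^ m * E t₁ t₂ := by
    have := det_submatrix_cons_insertNth Y I (Fin.last m) t₁ t₂ T
    rw [Fin.insertNth_last', Fin.val_last, ← hJeq] at this
    exact this
  have hanti : E s t₂ = -E t₂ s := by
    have h2 := det_submatrix_insertNth Y I (Fin.succ 0) t₂ (Fin.cons s T : Fin (m + 1) → ℕ)
    rw [Fin.insertNth_succ_cons, Fin.insertNth_zero'] at h2
    simpa using h2
  have hpl : L s * E t₁ t₂ = L t₁ * E s t₂ + L t₂ * E t₁ s :=
    plucker_three_term Y I i₀.succAbove T t₁ t₂ s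
  have e₁' : 0 < (-1) ^ (p : ℕ) * L s :=
    lt_of_le_of_ne e₁ (mul_ne_zero (pow_ne_zero _ (by norm_num)) hLs).symm
  have hfinal : ((-1) ^ (p : ℕ) * L s) * ((-1) ^ m * E t₁ t₂) =
      L t₁ * ((-1) ^ (m + 1) * ((-1) ^ (p : ℕ) * E t₂ s)) +
        ((-1) ^ m * L t₂) * ((-1) ^ (p : ℕ) * E t₁ s) := by
    rw [hanti] at hpl
    rw [pow_succ]
    linear_combination ((-1) ^ (p : ℕ) * (-1) ^ m) * hpl
  rw [← e₆] at hfinal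
  have h1 := mul_neg_of_pos_of_neg e₁' hneg
  have h2 := add_nonneg (mul_nonneg e₂ e₄) (mul_nonneg e₃ e₅)
  rw [hfinal] at h1
  exact absurd h1 (not_lt.mpr h2)

end Fekete

/-! ### Krylov sequences -/

section Krylov

variable {n : ℕ}

/-- The infinite controllability matrix `(b, A b, A² b, …)`. -/
def krylovMatrix (A : Matrix (Fin n) (Fin n) ℝ) (b : Fin n → ℝ) : Matrix (Fin n) ℕ ℝ :=
  Matrix.of fun i s => (A ^ s *ᵥ b) i

lemma MinorsNonneg.transpose {ι κ : Type*} [LinearOrder ι] [LinearOrder κ] {k : ℕ∞}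
    {M : Matrix κ ι ℝ} (h : MinorsNonneg k M) : MinorsNonneg k Mᵀ := fun j hj I J => by
  rw [← det_transpose]
  exact h j hj J I

/-- If all maximal minors of `j` consecutive Krylov vectors starting with `A ^ t b` vanish, then any
`j` Krylov vectors from `A ^ t b` on are linearly dependent: they lie in the image of the polynomials
modulo a nonzero polynomial of degree less than `j`. -/
lemma exists_krylov_relation {A : Matrix (Fin n) (Fin n) ℝ} {b : Fin n → ℝ} {j t : ℕ}
    (h : ∀ I : Fin j ↪o Fin n,
      ((krylovMatrix A b).submatrix I (fun i : Fin j => t + i)).det = 0)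
    (J : Fin j → ℕ) (hJ : ∀ i, t ≤ J i) :
    ∃ w : Fin j → ℝ, w ≠ 0 ∧ (krylovMatrix A b).submatrix id J *ᵥ w = 0 := by
  set Z := (krylovMatrix A b).submatrix id (fun i : Fin j => t + (i : ℕ)) with hZ
  -- the Gram determinant is the sum of the squared maximal minors
  have hgram : (Zᵀ * Z).det = 0 := by
    rw [det_mul_eq_sum]
    refine Finset.sum_eq_zero fun I _ => ?_
    have : Z.submatrix I id = (krylovMatrix A b).submatrix I (fun i : Fin j => t + i) := rfl
    rw [this, h, mul_zero]
  obtain ⟨v, hv0, hv⟩ := exists_mulVec_eq_zero_iff.mpr hgram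
  have hZv : Z *ᵥ v = 0 := by
    have := (conjTranspose_mul_self_mulVec_eq_zero Z v).mp (by
      rwa [conjTranspose_eq_transpose_of_trivial])
    exact this
  set φ : Polynomial ℝ → Fin n → ℝ := fun p => (A ^ t * Polynomial.aeval A p) *ᵥ b with hφ
  have hφmul : ∀ p q, φ p = 0 → φ (p * q) = 0 := fun p q hp => by
    have e : A ^ t * Polynomial.aeval A (p * q) =
        Polynomial.aeval A q * (A ^ t * Polynomial.aeval A p) := by
      rw [← Polynomial.aeval_X (R := ℝ) A, ← map_pow, Polynomial.aeval_X, ← map_mul, ← map_mul,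
        ← map_mul]
      congr 1
      ring
    simp only [hφ] at hp ⊢
    rw [e, ← mulVec_mulVec, hp, mulVec_zero]
  have hφsum : ∀ (d : Fin j → ℕ) (c : Fin j → ℝ),
      φ (∑ i, Polynomial.C (c i) * Polynomial.X ^ d i) =
        (krylovMatrix A b).submatrix id (fun i => t + d i) *ᵥ c := fun d c => by
    simp only [hφ, map_sum, map_mul, Polynomial.aeval_C, map_pow, Polynomial.aeval_X]
    rw [Finset.mul_sum, sum_mulVec]
    ext a
    rw [Finset.sum_apply, mulVec, dotProduct]
    refine Finset.sum_congr rfl fun i _ => ?_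
    rw [← Algebra.smul_def, mul_smul_comm, ← pow_add, smul_mulVec]
    simp [krylovMatrix, mul_comm]
  set q : Polynomial ℝ := ∑ i : Fin j, Polynomial.C (v i) * Polynomial.X ^ (i : ℕ) with hq
  have hφq : φ q = 0 := by
    rw [hq, hφsum (fun i => i)]
    exact hZv
  have hqcoeff : ∀ i : Fin j, q.coeff i = v i := fun i => by
    simp [hq, Polynomial.finsetSum_coeff, Polynomial.coeff_C_mul, Polynomial.coeff_X_pow,
      Fin.val_inj]
  have hq0 : q ≠ 0 := fun h0 => hv0 (funext fun i => by rw [← hqcoeff, h0]; simp)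
  have hqdeg : q.natDegree < j := by
    have hj : 0 < j := by
      rcases Nat.eq_zero_or_pos j with rfl | h
      · exact absurd (Subsingleton.elim v 0) hv0
      · exact h
    rw [Polynomial.natDegree_lt_iff_degree_lt hq0]
    refine (Polynomial.degree_sum_le _ _).trans_lt ?_
    rw [Finset.sup_lt_iff (by exact WithBot.bot_lt_coe j)]
    intro i _
    refine (Polynomial.degree_C_mul_X_pow_le _ _).trans_lt ?_
    exact_mod_cast i.2
  -- remainders modulo the monic normalization of `q`
  set q' := q * Polynomial.C q.leadingCoeff⁻¹ with hq'
  have hmonic : q'.Monic := Polynomial.monic_mul_leadingCoeff_inv hq0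
  have hdeg' : q'.natDegree = q.natDegree := Polynomial.natDegree_mul_leadingCoeff_inv q hq0
  set Λ : (Fin j → ℝ) →ₗ[ℝ] (Fin q'.natDegree → ℝ) :=
    { toFun := fun c i =>
        ((∑ a, Polynomial.C (c a) * Polynomial.X ^ (J a - t)) %ₘ q').coeff i
      map_add' := fun c d => by
        ext i
        simp [add_mul, Finset.sum_add_distrib, Polynomial.add_modByMonic]
      map_smul' := fun r c => by
        ext i
        have : ∑ a, Polynomial.C ((r • c) a) * Polynomial.X ^ (J a - t) =
            r • ∑ a, Polynomial.C (c a) * Polynomial.X ^ (J a - t) := by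
          rw [Finset.smul_sum]
          refine Finset.sum_congr rfl fun a _ => ?_
          simp [Polynomial.smul_eq_C_mul, mul_assoc]
        rw [this, Polynomial.smul_modByMonic]
        simp } with hΛ
  have hker : LinearMap.ker Λ ≠ ⊥ := LinearMap.ker_ne_bot_of_finrank_lt (by
    rw [Module.finrank_fin_fun, Module.finrank_fin_fun]
    omega)
  obtain ⟨w, hw, hw0⟩ := Submodule.exists_mem_ne_zero_of_ne_bot hker
  refine ⟨w, hw0, ?_⟩
  have hmod : (∑ a, Polynomial.C (w a) * Polynomial.X ^ (J a - t)) %ₘ q' = 0 := by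
    ext i
    by_cases hi : i < q'.natDegree
    · exact congrFun (LinearMap.mem_ker.mp hw) ⟨i, hi⟩
    · rw [Polynomial.coeff_zero]
      refine Polynomial.coeff_eq_zero_of_degree_lt ?_
      refine (Polynomial.degree_modByMonic_lt _ hmonic).trans_le ?_
      rw [Polynomial.degree_eq_natDegree hmonic.ne_zero]
      exact_mod_cast not_lt.mp hi
  obtain ⟨r, hr⟩ := (Polynomial.modByMonic_eq_zero_iff_dvd hmonic).mp hmod
  have h1 := hφsum (fun a => J a - t) w
  rw [hr, hq', mul_assoc, hφmul _ _ hφq] at h1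
  have h2 : (fun a => t + (J a - t)) = J := funext fun a => by
    have := hJ a
    omega
  rw [h2] at h1
  exact h1.symm

lemma krylovMatrix_succ (A : Matrix (Fin n) (Fin n) ℝ) (b : Fin n → ℝ) {j : ℕ} (t : ℕ) :
    (krylovMatrix A b).submatrix id (fun i : Fin j => t + 1 + (i : ℕ)) =
      A * (krylovMatrix A b).submatrix id (fun i : Fin j => t + (i : ℕ)) := by
  ext a i
  have : A ^ (t + 1 + (i : ℕ)) *ᵥ b = A *ᵥ (A ^ (t + (i : ℕ)) *ᵥ b) := by
    rw [mulVec_mulVec, ← pow_succ']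
    congr 2
    omega
  exact congrFun this a

lemma det_krylov_consecutive_nonneg {k : ℕ∞} {A : Matrix (Fin n) (Fin n) ℝ} {b : Fin n → ℝ}
    (hA : MinorsNonneg k A)
    (hb : ∀ j : ℕ, (j : ℕ∞) ≤ k → ∀ I : Fin j ↪o Fin n,
      0 ≤ ((krylovMatrix A b).submatrix I (fun i : Fin j => (i : ℕ))).det)
    {j : ℕ} (hj : (j : ℕ∞) ≤ k) (t : ℕ) (I : Fin j ↪o Fin n) :
    0 ≤ ((krylovMatrix A b).submatrix I (fun i : Fin j => t + i)).det := by
  induction t generalizing I with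
  | zero => simpa using hb j hj I
  | succ t ih =>
    have : (krylovMatrix A b).submatrix I (fun i : Fin j => t + 1 + i) =
        A.submatrix I id * (krylovMatrix A b).submatrix id (fun i : Fin j => t + (i : ℕ)) := by
      have h := congrArg (fun M => M.submatrix I id) (krylovMatrix_succ A b (j := j) t)
      exact h
    rw [this, det_mul_eq_sum]
    exact Finset.sum_nonneg fun K _ => mul_nonneg (hA j hj I K) (ih K)

open Filter Topology in
/-- If the minors of `A` and of the truncated controllability matrices are nonnegative up to order
`k`, then so are all minors of the infinite controllability matrix. Multiplication by the Cauchy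
kernel makes the minors with consecutive columns positive unless the columns are dependent. -/
lemma minorsNonneg_krylovMatrix {k : ℕ∞} {A : Matrix (Fin n) (Fin n) ℝ} {b : Fin n → ℝ}
    (hA : MinorsNonneg k A)
    (hb : ∀ j : ℕ, (j : ℕ∞) ≤ k → ∀ I : Fin j ↪o Fin n,
      0 ≤ ((krylovMatrix A b).submatrix I (fun i : Fin j => (i : ℕ))).det) :
    MinorsNonneg k (krylovMatrix A b) := by
  have hG : ∀ R : ℝ, 1 < R → MinorsNonneg k (cauchyKernel n R * krylovMatrix A b) := by
    intro R hR
    refine minorsNonneg_of_consecutive fun j hj t => ?_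
    by_cases hz : ∀ I : Fin j ↪o Fin n,
        ((krylovMatrix A b).submatrix I (fun i : Fin j => t + i)).det = 0
    · right
      intro I J hJ
      obtain ⟨w, hw0, hw⟩ := exists_krylov_relation hz J hJ
      refine exists_mulVec_eq_zero_iff.mp ⟨w, hw0, ?_⟩
      have : (cauchyKernel n R * krylovMatrix A b).submatrix I J =
          (cauchyKernel n R).submatrix I id * (krylovMatrix A b).submatrix id J := rfl
      rw [this, ← mulVec_mulVec, hw, mulVec_zero]
    · left
      intro I
      push Not at hz
      obtain ⟨K, hK⟩ := hz
      have : (cauchyKernel n R * krylovMatrix A b).submatrix I (fun i : Fin j => t + i) =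
          (cauchyKernel n R).submatrix I id *
            (krylovMatrix A b).submatrix id (fun i : Fin j => t + (i : ℕ)) := rfl
      rw [this, det_mul_eq_sum]
      have hnn := det_krylov_consecutive_nonneg hA hb hj t
      refine Finset.sum_pos' (fun K _ => ?_) ⟨K, Finset.mem_univ K, ?_⟩
      · exact mul_nonneg (det_cauchyKernel_submatrix_pos hR I K).le (hnn K)
      · exact mul_pos (det_cauchyKernel_submatrix_pos hR I K)
          (lt_of_le_of_ne (hnn K) hK.symm)
  intro j hj I J
  have hcont : Continuous fun G : Matrix (Fin n) (Fin n) ℝ =>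
      ((G * krylovMatrix A b).submatrix I J).det :=
    ((continuous_id.matrix_mul continuous_const).matrix_submatrix I J).matrix_det
  have hlim := (hcont.tendsto 1).comp (tendsto_cauchyKernel n)
  rw [Matrix.one_mul] at hlim
  refine ge_of_tendsto hlim ?_
  filter_upwards [eventually_gt_atTop 1] with R hR
  exact hG R hR j hj I J

end Krylov

/-! ### Stability -/

open Filter Topology in
open scoped Matrix.Norms.Operator ENNReal in
/-- By Gelfand's formula the powers of a stable matrix decay geometrically. -/
lemma IsStable.summable_pow {n : ℕ} {A : Matrix (Fin n) (Fin n) ℝ} (hA : IsStable A)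
    (i j : Fin n) : Summable fun s : ℕ => (A ^ s) i j := by
  have : Nonempty (Fin n) := ⟨i⟩
  set B := A.map (algebraMap ℝ ℂ) with hB
  have hρ : spectralRadius ℂ B < ((1 : NNReal) : ℝ≥0∞) :=
    spectrum.spectralRadius_lt_of_forall_lt B fun z hz => by
      have := hA z hz
      exact_mod_cast this
  obtain ⟨r, hr1, hr2⟩ := ENNReal.lt_iff_exists_nnreal_btwn.mp hρ
  have hr : (r : ℝ) < 1 := by exact_mod_cast hr2
  have hev := (spectrum.pow_nnnorm_pow_one_div_tendsto_nhds_spectralRadius B).eventually_lt_const hr1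
  have hsum : Summable fun s : ℕ => B ^ s := by
    refine Summable.of_norm_bounded_eventually_nat (summable_geometric_of_lt_one r.coe_nonneg hr) ?_
    filter_upwards [hev, eventually_gt_atTop 0] with s hs hs0
    have hs0' : (s : ℝ) ≠ 0 := by exact_mod_cast hs0.ne'
    have h1 := ENNReal.rpow_le_rpow hs.le (Nat.cast_nonneg (α := ℝ) s)
    rw [← ENNReal.rpow_mul, one_div_mul_cancel hs0', ENNReal.rpow_one, ENNReal.rpow_natCast] at h1
    exact_mod_cast h1
  have hentry : Summable fun s : ℕ => (B ^ s) i j :=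
    Pi.summable.mp (Pi.summable.mp hsum i) j
  have hmap : ∀ s : ℕ, (B ^ s) i j = (((A ^ s) i j : ℝ) : ℂ) := fun s => by
    have : B ^ s = (A ^ s).map (algebraMap ℝ ℂ) := by
      rw [hB, ← RingHom.mapMatrix_apply, ← map_pow, RingHom.mapMatrix_apply]
    rw [this]
    rfl
  simp only [hmap] at hentry
  exact Complex.summable_ofReal.mp hentry

lemma System.hasSum_conOp {n : ℕ} {S : System (Fin n)} (hS : IsStable S.A) {u : ℕ → ℝ}
    {M : ℝ} (hu : ∀ s, |u s| ≤ M) (i : Fin n) :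
    HasSum (fun s => u s * krylovMatrix S.A S.b i s) (S.conOp u i) := by
  have hsum : ∀ i, Summable fun s => u s * (S.A ^ s *ᵥ S.b) i := fun i => by
    have h1 : Summable fun s : ℕ => (S.A ^ s *ᵥ S.b) i := by
      simp only [mulVec, dotProduct]
      exact summable_sum fun j _ => (hS.summable_pow i j).mul_right _
    refine Summable.of_norm_bounded (g := fun s => M * |(S.A ^ s *ᵥ S.b) i|)
      (h1.abs.mul_left M) fun s => ?_
    rw [Real.norm_eq_abs, abs_mul]
    exact mul_le_mul_of_nonneg_right (hu s) (abs_nonneg _)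
  have hvec : Summable fun s => u s • (S.A ^ s *ᵥ S.b) := Pi.summable.mpr hsum
  exact Pi.hasSum.mp hvec.hasSum i

/-! ### Internal positivity and the equivalence -/

lemma System.isInternallyPositive_iff {ι : Type*} [Fintype ι] [DecidableEq ι] (S : System ι) :
    S.IsInternallyPositive ↔
      (∀ i j, 0 ≤ S.A i j) ∧ (∀ i, 0 ≤ S.b i) ∧ ∀ i, 0 ≤ S.c i := by
  constructor
  · intro h
    have hsingle : ∀ j i, 0 ≤ (Pi.single j 1 : ι → ℝ) i := fun j i => by
      by_cases hij : i = j
      · subst hij; simp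
      · simp [hij]
    refine ⟨fun i j => ?_, fun i => ?_, fun j => ?_⟩
    · have := (h (Pi.single j 1) 0 (hsingle j) fun _ => le_rfl).2 1 i
      simpa [System.state] using this
    · have := (h 0 1 (fun _ => le_rfl) fun _ => zero_le_one).2 1 i
      simpa [System.state] using this
    · have := (h (Pi.single j 1) 0 (hsingle j) fun _ => le_rfl).1 0
      simpa [System.output, System.state] using this
  · rintro ⟨hA, hb, hc⟩ x₀ u hx hu
    have hstate : ∀ t i, 0 ≤ S.state x₀ u t i := by
      intro t
      induction t with
      | zero => exact hx
      | succ t ih =>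
        intro i
        simp only [System.state, Pi.add_apply, Pi.smul_apply, smul_eq_mul]
        exact add_nonneg (Finset.sum_nonneg fun j _ => mul_nonneg (hA i j) (ih j))
          (mul_nonneg (hu t) (hb i))
    exact ⟨fun t => Finset.sum_nonneg fun i _ => mul_nonneg (hc i) (hstate t i), hstate⟩

instance subsingleton_orderEmbedding_fin (j : ℕ) : Subsingleton (Fin j ↪o Fin j) :=
  ⟨fun I J => OrderEmbedding.range_inj.mp (by
    rw [(Finite.surjective_of_injective I.injective).range_eq,
      (Finite.surjective_of_injective J.injective).range_eq])⟩

lemma hasSum_extend {ι E : Type*} [AddCommMonoid E] [TopologicalSpace E] [Module ℝ E] {j : ℕ}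
    {J : Fin j → ι} (hJ : Function.Injective J) (w : Fin j → ℝ) (v : ι → E) :
    HasSum (fun s => Function.extend J w 0 s • v s) (∑ r, w r • v (J r)) := by
  refine (hJ.hasSum_iff fun s hs => ?_).mp ?_
  · rw [Function.extend_apply' _ _ _ hs]
    simp
  · convert hasSum_fintype (fun r => w r • v (J r)) using 2 with r
    simp [hJ.extend_apply]

lemma System.obsOp_apply {n : ℕ} (S : System (Fin n)) (x : Fin n → ℝ) (t : ℕ) :
    S.obsOp x t = ((krylovMatrix S.Aᵀ S.c)ᵀ *ᵥ x) t := by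
  have : (krylovMatrix S.Aᵀ S.c)ᵀ t = S.c ᵥ* S.A ^ t := by
    ext i
    simp [krylovMatrix, ← transpose_pow, mulVec_transpose]
  rw [System.obsOp, dotProduct_mulVec, ← this]
  rfl

lemma isOVD_mulVec {n : ℕ} {κ : Type*} [LinearOrder κ] [LocallyFiniteOrderBot κ] [WellFoundedLT κ]
    {k : ℕ∞} (hk : 1 ≤ k) {M : Matrix κ (Fin n) ℝ} :
    IsOVD (k - 1) Set.univ (fun x => M *ᵥ x) ↔ MinorsNonneg k M := by
  refine ⟨fun h => minorsNonneg_of_isOVD h fun j J w => ⟨Set.mem_univ _, fun i => ?_⟩, fun h =>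
    isOVD_of_minorsNonneg hk h (fun u _ i => ?_) (Or.inl inferInstance)⟩
  · have h1 := (hasSum_extend J.injective w (fun s => M i s)).unique (hasSum_fintype _)
    simp only [smul_eq_mul] at h1
    simp only [mulVec, dotProduct]
    calc ∑ s, M i s * Function.extend J w 0 s = ∑ s, Function.extend J w 0 s * M i s :=
          Finset.sum_congr rfl fun s _ => mul_comm _ _
      _ = ∑ r, w r * M i (J r) := h1.symm
      _ = _ := Finset.sum_congr rfl fun s _ => mul_comm _ _
  · have : (M *ᵥ u) i = ∑ s, u s * M i s := by
      simp only [mulVec, dotProduct, mul_comm]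
    rw [this]
    exact hasSum_fintype _

lemma isOVD_conOp {n : ℕ} {k : ℕ∞} (hk : 1 ≤ k) {S : System (Fin n)} (hS : IsStable S.A) :
    IsOVD (k - 1) {u : ℕ → ℝ | ∃ M : ℝ, ∀ s, |u s| ≤ M} S.conOp ↔
      MinorsNonneg k (krylovMatrix S.A S.b) := by
  refine ⟨fun h => minorsNonneg_of_isOVD h fun j J w => ⟨⟨∑ r, |w r|, fun s => ?_⟩, fun i => ?_⟩,
    fun h => isOVD_of_minorsNonneg hk h (fun u ⟨M, hM⟩ i => S.hasSum_conOp hS hM i)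
      (Or.inr inferInstance)⟩
  · by_cases hs : ∃ r, J r = s
    · obtain ⟨r, rfl⟩ := hs
      rw [J.injective.extend_apply]
      exact Finset.single_le_sum (f := fun r => |w r|) (fun r _ => abs_nonneg _) (Finset.mem_univ r)
    · rw [Function.extend_apply' _ _ _ hs]
      simpa using Finset.sum_nonneg fun r _ => abs_nonneg (w r)
  · have h1 := (hasSum_extend J.injective w (fun s => S.A ^ s *ᵥ S.b)).tsum_eq
    rw [System.conOp, h1, Finset.sum_apply]
    exact Finset.sum_congr rfl fun r _ => mul_comm _ _

lemma isInternallyHankelPos_iff {n : ℕ} {k : ℕ∞} (hk : 1 ≤ k) {S : System (Fin n)}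
    (hS : IsStable S.A) :
    S.IsInternallyHankelPos k ↔ MinorsNonneg k S.A ∧ MinorsNonneg k (krylovMatrix S.A S.b) ∧
      MinorsNonneg k (krylovMatrix S.Aᵀ S.c) := by
  have hobs : S.obsOp = fun x => (krylovMatrix S.Aᵀ S.c)ᵀ *ᵥ x :=
    funext fun x => funext fun t => S.obsOp_apply x t
  rw [System.IsInternallyHankelPos, isOVD_mulVec hk, isOVD_conOp hk hS, hobs, isOVD_mulVec hk]
  exact and_congr_right' (and_congr_right' ⟨fun h => h.transpose, fun h => h.transpose⟩)

lemma compound_obsMat {n j : ℕ} (A : Matrix (Fin n) (Fin n) ℝ) (c : Fin n → ℝ)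
    (I : Fin j ↪o Fin j) (J : Fin j ↪o Fin n) :
    compound j (obsMat j A c) I J = compound j (conMat j Aᵀ c) J I := by
  simp only [compound, of_apply, obsMat]
  rw [← det_transpose]
  rfl

lemma compound_conMat {n j : ℕ} (A : Matrix (Fin n) (Fin n) ℝ) (b : Fin n → ℝ)
    (I : Fin j ↪o Fin n) (J : Fin j ↪o Fin j) :
    compound j (conMat j A b) I J =
      ((krylovMatrix A b).submatrix I (fun i : Fin j => (i : ℕ))).det := by
  rw [Subsingleton.elim J (fullSet j)]
  rfl

lemma minorsNonneg_iff_compound {n : ℕ} {k : ℕ∞} {S : System (Fin n)} :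
    (MinorsNonneg k S.A ∧ MinorsNonneg k (krylovMatrix S.A S.b) ∧
      MinorsNonneg k (krylovMatrix S.Aᵀ S.c)) ↔
    ∀ j : ℕ, 1 ≤ j → (j : ℕ∞) ≤ k →
      (∀ I J, 0 ≤ compound j S.A I J) ∧
      (∀ I J, 0 ≤ compound j (conMat j S.A S.b) I J) ∧
      (∀ I J, 0 ≤ compound j (obsMat j S.A S.c) I J) := by
  constructor
  · rintro ⟨hA, hb, hc⟩ j - hj
    refine ⟨fun I J => hA j hj I J, fun I J => ?_, fun I J => ?_⟩
    · rw [compound_conMat]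
      exact hb j hj I (Fin.valOrderEmb j)
    · rw [compound_obsMat, compound_conMat]
      exact hc j hj J (Fin.valOrderEmb j)
  · intro h
    have hA : MinorsNonneg k S.A := fun j hj I J => by
      rcases Nat.eq_zero_or_pos j with rfl | hj0
      · simp
      · exact (h j hj0 hj).1 I J
    refine ⟨hA, minorsNonneg_krylovMatrix hA fun j hj I => ?_,
      minorsNonneg_krylovMatrix hA.transpose fun j hj I => ?_⟩
    · rcases Nat.eq_zero_or_pos j with rfl | hj0
      · simp
      · rw [← compound_conMat S.A S.b I (fullSet j)]
        exact (h j hj0 hj).2.1 _ _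
    · rcases Nat.eq_zero_or_pos j with rfl | hj0
      · simp
      · rw [← compound_conMat S.Aᵀ S.c I (fullSet j), ← compound_obsMat]
        exact (h j hj0 hj).2.2 _ _

lemma isInternallyPositive_compoundSystem_iff {n : ℕ} (S : System (Fin n)) (j : ℕ) :
    (S.compoundSystem j).IsInternallyPositive ↔
      (∀ I J, 0 ≤ compound j S.A I J) ∧
      (∀ I J, 0 ≤ compound j (conMat j S.A S.b) I J) ∧
      (∀ I J, 0 ≤ compound j (obsMat j S.A S.c) I J) := by
  rw [System.isInternallyPositive_iff]
  refine and_congr Iff.rfl (and_congr ⟨fun h I J => ?_, fun h I => h I _⟩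
    ⟨fun h I J => ?_, fun h I => h _ I⟩)
  · rw [Subsingleton.elim J (fullSet j)]
    exact h I
  · rw [Subsingleton.elim I (fullSet j)]
    exact h J

end HankelPos

theorem mainTheorem2 (n : ℕ) (k : ℕ∞) (hk : 1 ≤ k) (S : HankelPos.System (Fin n))
    (hS : HankelPos.IsStable S.A) :
    (S.IsInternallyHankelPos k ↔
      ∀ j : ℕ, 1 ≤ j → (j : ℕ∞) ≤ k → (S.compoundSystem j).IsInternallyPositive) ∧
    (S.IsInternallyHankelPos k ↔
      ∀ j : ℕ, 1 ≤ j → (j : ℕ∞) ≤ k →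
        (∀ I J, 0 ≤ HankelPos.compound j S.A I J) ∧
        (∀ I J, 0 ≤ HankelPos.compound j (HankelPos.conMat j S.A S.b) I J) ∧
        (∀ I J, 0 ≤ HankelPos.compound j (HankelPos.obsMat j S.A S.c) I J)) := by
  simp only [HankelPos.isInternallyPositive_compoundSystem_iff, and_self]
  rw [HankelPos.isInternallyHankelPos_iff hk hS]
  exact HankelPos.minorsNonneg_iff_compound
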